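/- Let $a=(a_n)$, $p=(p_n)$, $q=(q_n)$, $n\in\mathbb Z$, be complex sequences with $a_n\neq 0$ for all $n$ and $$\sum_{n\in\mathbb Z}|n|\bigl(|1-a_n|+|p_n|+|q_n|\bigr)<\infty .$$ For $\lambda\in\mathbb C$ let $L_\lambda$ be the operator in $\ell^2(\mathbb Z)$ given by $$(L_\lambda y)_n=\Delta(a_{n-1}\Delta y_{n-1})+(q_n+2\lambda p_n+\lambda^2)y_n,\qquad \Delta y_n=y_{n+1}-y_n .$$ The resolvent set $\rho$ consists of the $\lambda$ for which $L_\lambda^{-1}$ exists as a bounded operator on $\ell^2(\mathbb Z)$; for $\lambda\in\rho$ let $G_{n,m}(\lambda)$ be the kernel (matrix entries) of $L_\lambda^{-1}$. The continuous spectrum $\sigma_c$ consists of the $\lambda\notin\rho$ for which $L_\lambda$ is injective with dense range. A spectral singularity is a point $\lambda_0\in\sigma_c$, different from the thresholds $0,2,-2$, at which the kernel of the resolvent has a pole on one of the two sides of the real line, that is: for $H=\{\operatorname{Im}\lambda>0\}$ or for $H=\{\operatorname{Im}\lambda<0\}$, $\lambda_0$ is a limit point of $\rho\cap H$ and $|G_{n,m}(\lambda)|\to\infty$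 as $\lambda\to\lambda_0$, $\lambda\in\rho\cap H$, for some $n,m$. Let $\sigma_{ss}$ be the set of spectral singularities. Put $P_0=(-\pi,3\pi)\setminus\{0,\pi,2\pi\}$. Then for every $z\in P_0$ and $\lambda=2\cos(z/2)$ the equation $\Delta(a_{n-1}\Delta y_{n-1})+(q_n+2\lambda p_n+\lambda^2)y_n=0$, $n\in\mathbb Z$, has a unique solution $f^+(z)$ with $f^+_n(z)=(-1)^ne^{inz}(1+o(1))$ as $n\to\infty$ and a unique solution $f^-(z)$ with $f^-_n(z)=(-1)^ne^{-inz}(1+o(1))$ as $n\to-\infty$ (the Jost solutions), and, with the Wronskian (which does not depend on $n$) $$\Phi(z)=W[f^-(z),f^+(z)]=a_n\bigl(f^-_n(z)f^+_{n+1}(z)-f^-_{n+1}(z)f^+_n(z)\bigr),$$ we have $$\sigma_{ss}=\Bigl\{\lambda=2\cos\tfrac z2:\ z\in P_0\text{ and }\Phi(z)=0\Bigr\}.$$ -/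

import Mathlib

open Filter Topology

noncomputable section

namespace QuadPencil

/-- The Hilbert space `ℓ²(ℤ)` of complex square summable sequences. -/
abbrev Ell2 : Type := lp (fun _ : ℤ => ℂ) 2

/-- The difference expression
`Δ (a_{n-1} Δ y_{n-1}) + (q_n + 2 l p_n + l ^ 2) y_n`, acting on all complex sequences. -/
def expr (a p q : ℤ → ℂ) (l : ℂ) : (ℤ → ℂ) →ₗ[ℂ] (ℤ → ℂ) where
  toFun y n := fwdDiff 1 (fun k : ℤ => a (k - 1) * fwdDiff 1 y (k - 1)) n
    + (q n + 2 * l * p n + l ^ 2) * y n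
  map_add' y w := by
    funext n
    simp only [fwdDiff, Pi.add_apply]
    ring
  map_smul' c y := by
    funext n
    simp only [fwdDiff, Pi.smul_apply, smul_eq_mul, RingHom.id_apply]
    ring

theorem expr_apply (a p q : ℤ → ℂ) (l : ℂ) (y : ℤ → ℂ) (n : ℤ) :
    expr a p q l y n = a n * y (n + 1) + a (n - 1) * y (n - 1)
      + (q n - a n - a (n - 1) + 2 * l * p n + l ^ 2) * y n := by
  simp only [expr, LinearMap.coe_mk, AddHom.coe_mk, fwdDiff, add_sub_cancel_right, sub_add_cancel]
  ring

/-- The operator `L_l` generated in `ℓ²(ℤ)` by the difference expression, with its maximal domain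
(which is all of `ℓ²(ℤ)` when the coefficients are bounded). -/
def pencil (a p q : ℤ → ℂ) (l : ℂ) : Ell2 →ₗ.[ℂ] Ell2 where
  domain :=
    { carrier := {y | Memℓp (expr a p q l (y : ℤ → ℂ)) 2}
      add_mem' := by
        intro y w hy hw
        have h := Memℓp.add hy hw
        rwa [← map_add] at h
      zero_mem' := by
        have h : expr a p q l ((0 : Ell2) : ℤ → ℂ) = 0 := map_zero _
        change Memℓp (expr a p q l ((0 : Ell2) : ℤ → ℂ)) 2
        rw [h]
        exact zero_memℓp
      smul_mem' := by
        intro c y hy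
        have h := Memℓp.const_smul hy c
        rwa [← map_smul] at h }
  toFun :=
    { toFun := fun y => ⟨expr a p q l ((y : Ell2) : ℤ → ℂ), y.2⟩
      map_add' := fun y w => Subtype.ext (map_add (expr a p q l) _ _)
      map_smul' := fun c y => Subtype.ext (map_smul (expr a p q l) c _) }

/-- `R` is a bounded, everywhere defined, two-sided inverse of the operator `T`. -/
def IsBoundedInverse (T : Ell2 →ₗ.[ℂ] Ell2) (R : Ell2 →L[ℂ] Ell2) : Prop :=
  (∀ φ : Ell2, ∃ h : R φ ∈ T.domain, T ⟨R φ, h⟩ = φ) ∧ ∀ y : T.domain, R (T y) = y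

/-- The resolvent set: those `l` for which `L_l⁻¹` exists as a bounded operator on `ℓ²(ℤ)`. -/
def resolventSet (a p q : ℤ → ℂ) : Set ℂ :=
  {l | ∃ R : Ell2 →L[ℂ] Ell2, IsBoundedInverse (pencil a p q l) R}

open Classical in
/-- The resolvent operator `L_l⁻¹` (zero when `l` is not in the resolvent set). -/
def resolvent (a p q : ℤ → ℂ) (l : ℂ) : Ell2 →L[ℂ] Ell2 :=
  if h : ∃ R : Ell2 →L[ℂ] Ell2, IsBoundedInverse (pencil a p q l) R then h.choose else 0

/-- The kernel `G_{n,m}` of the resolvent: `(L_l⁻¹ φ)_n = ∑ₘ G_{n,m} φ_m`, so that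
`G_{n,m}` is the `n`-th entry of `L_l⁻¹` applied to the `m`-th unit vector. -/
def resolventKernel (a p q : ℤ → ℂ) (l : ℂ) (n m : ℤ) : ℂ :=
  (resolvent a p q l (lp.single 2 m (1 : ℂ)) : ℤ → ℂ) n

/-- The continuous spectrum: `L_l` is injective with dense range, but has no bounded inverse
on `ℓ²(ℤ)`. -/
def continuousSpectrum (a p q : ℤ → ℂ) : Set ℂ :=
  {l | Function.Injective (pencil a p q l) ∧ Dense (Set.range (pencil a p q l)) ∧
    l ∉ resolventSet a p q}

/-- The kernel of the resolvent becomes infinite at `l₀`, when `l₀` is approached through the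
points of the resolvent set that lie in `S`: `l₀` is a limit of such points, and
`|G_{n,m}(l)| → ∞` along them for some entry `(n, m)`. -/
def KernelPoleWithin (a p q : ℤ → ℂ) (S : Set ℂ) (l₀ : ℂ) : Prop :=
  (𝓝[resolventSet a p q ∩ S] l₀).NeBot ∧
    ∃ n m : ℤ, Tendsto (fun l => ‖resolventKernel a p q l n m‖)
      (𝓝[resolventSet a p q ∩ S] l₀) atTop

/-- The spectral singularities: points of the continuous spectrum, other than the thresholds
`l = 0, 2, -2` (the values with `l ^ 2 = 0` or `l ^ 2 = 4`), at which the kernel of the resolvent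
has a pole. The continuous spectrum is a cut on the real line, so the pole is one of the kernel
on the upper or on the lower side of the cut. -/
def spectralSingularities (a p q : ℤ → ℂ) : Set ℂ :=
  {l₀ | l₀ ∈ continuousSpectrum a p q ∧ l₀ ∉ ({0, 2, -2} : Set ℂ) ∧
    (KernelPoleWithin a p q {l | 0 < l.im} l₀ ∨ KernelPoleWithin a p q {l | l.im < 0} l₀)}

/-- `y` is the Jost solution at `+∞` for `l = 2 cos (z / 2)`: it solves the equation, and
`y_n = (-1)^n e^{inz} (1 + o(1))` as `n → ∞`. The sign is forced: with all `a_n = 1` and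
`p = q = 0` the equation reads `y_{n+1} + y_{n-1} + 2 (cos z) y_n = 0`. -/
def IsJostPlus (a p q : ℤ → ℂ) (z : ℂ) (y : ℤ → ℂ) : Prop :=
  (∀ n, expr a p q (2 * Complex.cos (z / 2)) y n = 0) ∧
    Tendsto (fun n : ℤ => (-1 : ℂ) ^ n * Complex.exp (-(Complex.I * n * z)) * y n) atTop (𝓝 1)

/-- `y` is the Jost solution at `-∞` for `l = 2 cos (z / 2)`: it solves the equation, and
`y_n = (-1)^n e^{-inz} (1 + o(1))` as `n → -∞`. -/
def IsJostMinus (a p q : ℤ → ℂ) (z : ℂ) (y : ℤ → ℂ) : Prop :=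
  (∀ n, expr a p q (2 * Complex.cos (z / 2)) y n = 0) ∧
    Tendsto (fun n : ℤ => (-1 : ℂ) ^ n * Complex.exp (Complex.I * n * z) * y n) atBot (𝓝 1)

open Classical in
/-- The Jost solution `f⁺(z)`. -/
def jostPlus (a p q : ℤ → ℂ) (z : ℂ) : ℤ → ℂ :=
  if h : ∃ y, IsJostPlus a p q z y then h.choose else 0

open Classical in
/-- The Jost solution `f⁻(z)`. -/
def jostMinus (a p q : ℤ → ℂ) (z : ℂ) : ℤ → ℂ :=
  if h : ∃ y, IsJostMinus a p q z y then h.choose else 0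

/-- The Wronskian `W[u, v] = a_n (u_n v_{n+1} - u_{n+1} v_n)`, formed at `n`. -/
def wronskian (a : ℤ → ℂ) (u v : ℤ → ℂ) (n : ℤ) : ℂ :=
  a n * (u n * v (n + 1) - u (n + 1) * v n)

/-- The Wronskian of two solutions of the same equation does not depend on `n`. -/
theorem wronskian_eq_zero_index (a p q : ℤ → ℂ) (l : ℂ) (u v : ℤ → ℂ)
    (hu : ∀ n, expr a p q l u n = 0) (hv : ∀ n, expr a p q l v n = 0) (n : ℤ) :
    wronskian a u v n = wronskian a u v 0 := by
  have step : ∀ k : ℤ, wronskian a u v (k + 1) = wronskian a u v k := by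
    intro k
    have h1 := hu (k + 1)
    have h2 := hv (k + 1)
    rw [expr_apply] at h1 h2
    simp only [add_sub_cancel_right] at h1 h2
    simp only [wronskian]
    linear_combination u (k + 1) * h2 - v (k + 1) * h1
  induction n using Int.induction_on with
  | zero => rfl
  | succ k ih => rw [step, ih]
  | pred k ih =>
    rw [← ih, ← step (-(k : ℤ) - 1)]
    congr 1
    ring

/-- `Φ(z) = W[f⁻(z), f⁺(z)]`. -/
def Phi (a p q : ℤ → ℂ) (z : ℂ) : ℂ :=
  wronskian a (jostMinus a p q z) (jostPlus a p q z) 0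

/-- `P₀ = (-π, 3π) \ {0, π, 2π}`. -/
def P0 : Set ℝ := Set.Ioo (-Real.pi) (3 * Real.pi) \ {0, Real.pi, 2 * Real.pi}

end QuadPencil

end

noncomputable section

namespace QuadPencil

/-! Put ζ = e^{iz}, so that λ² = 2 + ζ + 1/ζ for λ = 2cos(z/2). Near each z₀ in `P0` the half plane
Im z > 0 is mapped locally biholomorphically onto one side of the cut [-2, 2]. There the kernel of
L_λ⁻¹ is the classical Green function f⁻_{min} f⁺_{max} / W[f⁻, f⁺]. Numerator and denominator
extend continuously to real z with ζ² ≠ 1, and some entry of the numerator is nonzero, so the kernel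
blows up exactly where the Wronskian vanishes.

Four facts carry this. Jost solutions exist, are holomorphic for Im z > 0 and continuous up to the
real points with ζ² ≠ 1; they are limits of products of nearly contractive 2 × 2 maps
(`Decaying.isJostPlus_jostSol`, `Decaying.tendstoLocallyUniformlyOn_jostVec`). Off the cut, the
pencil is an invertible operator plus a compact one, so λ ∈ ρ as soon as L_λ is injective
(`Decaying.mem_resolventSet_of_injective`), that is, as soon as the Wronskian is nonzero. At real z
with ζ² ≠ 1 no nonzero solution on a half line tends to zero, which places λ in the continuous
spectrum (`Decaying.mem_continuousSpectrum_of_real`). Finally, the Wronskian is not identically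
zero, so ρ accumulates at every such point from either side
(`Decaying.not_eventually_jostWronskian_eq_zero`).

`Decaying.kernelPoleWithin_iff` combines these on one side of the cut. Since `P0` covers each λ in
(-2, 2) \ {0} twice, once for each side, `Decaying.spectralSingularities_eq` follows. -/

/-- Nonzero `a`, and coefficients whose deviation from `a = 1`, `p = q = 0` is summable. -/
structure Decaying (a p q : ℤ → ℂ) : Prop where
  ne_zero : ∀ n, a n ≠ 0
  summable_a : Summable fun n => ‖1 - a n‖
  summable_p : Summable fun n => ‖p n‖
  summable_q : Summable fun n => ‖q n‖

theorem summable_of_summable_abs_mul {f g : ℤ → ℝ} (hf : ∀ n, 0 ≤ f n)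
    (hfg : ∀ n, f n ≤ g n) (h : Summable fun n : ℤ => |(n : ℝ)| * g n) : Summable f := by
  refine Summable.of_norm_bounded_eventually h ?_
  -- The weight |n| vanishes at 0, so the comparison holds only off one index.
  have h0 : ∀ᶠ n : ℤ in cofinite, n ≠ 0 := eventually_cofinite_ne 0
  filter_upwards [h0] with n hn
  have h1 : (1 : ℝ) ≤ |(n : ℝ)| := by exact_mod_cast Int.one_le_abs hn
  rw [Real.norm_of_nonneg (hf n)]
  nlinarith [hf n, hfg n]

theorem decaying_of_summable {a p q : ℤ → ℂ} (ha : ∀ n, a n ≠ 0)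
    (h : Summable fun n : ℤ => |(n : ℝ)| * (‖1 - a n‖ + ‖p n‖ + ‖q n‖)) : Decaying a p q where
  ne_zero := ha
  summable_a := summable_of_summable_abs_mul (fun _ => norm_nonneg _)
    (fun n => by linarith [norm_nonneg (p n), norm_nonneg (q n)]) h
  summable_p := summable_of_summable_abs_mul (fun _ => norm_nonneg _)
    (fun n => by linarith [norm_nonneg (1 - a n), norm_nonneg (q n)]) h
  summable_q := summable_of_summable_abs_mul (fun _ => norm_nonneg _)
    (fun n => by linarith [norm_nonneg (p n), norm_nonneg (1 - a n)]) h

/-! ### Translations and compact diagonal operators on ℓ²(ℤ) -/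

theorem memℓp_two_iff {f : ℤ → ℂ} : Memℓp f 2 ↔ Summable fun n => ‖f n‖ ^ 2 := by
  rw [memℓp_gen_iff (by simp)]
  simp

theorem Memℓp.comp_add_right {f : ℤ → ℂ} (hf : Memℓp f 2) (k : ℤ) :
    Memℓp (fun n => f (n + k)) 2 := by
  rw [memℓp_two_iff] at hf ⊢
  exact hf.comp_injective (add_left_injective k)

/-- Translation of sequences by `k`. -/
def shift (k : ℤ) : Ell2 →ₗᵢ[ℂ] Ell2 where
  toFun y := ⟨fun n => (y : ℤ → ℂ) (n + k), Memℓp.comp_add_right y.2 k⟩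
  map_add' _ _ := rfl
  map_smul' _ _ := rfl
  norm_map' y := by
    have h : (0 : ℝ) < (2 : ENNReal).toReal := by simp
    rw [lp.norm_eq_tsum_rpow h, lp.norm_eq_tsum_rpow h]
    congr 1
    exact (Equiv.addRight k).tsum_eq fun n => ‖(y : ℤ → ℂ) n‖ ^ (2 : ENNReal).toReal

/-- Multiplication by a summable sequence. -/
def diag (c : ℤ → ℂ) : Ell2 →L[ℂ] Ell2 :=
  ∑' n, c n • (lp.singleContinuousLinearMap ℂ (fun _ : ℤ => ℂ) 2 n).comp
    (lp.evalCLM ℂ (fun _ : ℤ => ℂ) 2 n)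

theorem norm_coordinate_le (n : ℤ) :
    ‖(lp.singleContinuousLinearMap ℂ (fun _ : ℤ => ℂ) 2 n).comp
      (lp.evalCLM ℂ (fun _ : ℤ => ℂ) 2 n)‖ ≤ 1 := by
  refine ContinuousLinearMap.opNorm_le_bound _ zero_le_one fun y => ?_
  simp only [ContinuousLinearMap.comp_apply, lp.singleContinuousLinearMap_apply, one_mul]
  rw [lp.norm_single (by simp)]
  exact lp.norm_apply_le_norm (by simp) y n

theorem summable_diag {c : ℤ → ℂ} (hc : Summable fun n => ‖c n‖) :
    Summable fun n => c n • (lp.singleContinuousLinearMap ℂ (fun _ : ℤ => ℂ) 2 n).comp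
      (lp.evalCLM ℂ (fun _ : ℤ => ℂ) 2 n) := by
  refine Summable.of_norm_bounded hc fun n => ?_
  rw [norm_smul]
  exact mul_le_of_le_one_right (norm_nonneg _) (norm_coordinate_le n)

theorem diag_apply {c : ℤ → ℂ} (hc : Summable fun n => ‖c n‖) (y : Ell2) (n : ℤ) :
    diag c y n = c n * y n := by
  have h := (summable_diag hc).hasSum
  have h1 := (h.mapL (ContinuousLinearMap.apply ℂ Ell2 y)).mapL
    (lp.evalCLM ℂ (fun _ : ℤ => ℂ) 2 n)
  have h2 := hasSum_single (f := fun k => lp.evalCLM ℂ (fun _ : ℤ => ℂ) 2 n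
    ((c k • (lp.singleContinuousLinearMap ℂ (fun _ : ℤ => ℂ) 2 k).comp
      (lp.evalCLM ℂ (fun _ : ℤ => ℂ) 2 k)) y)) n (fun k hk => by
        change c k * ((lp.single 2 k (y k) : Ell2) : ℤ → ℂ) n = 0
        rw [lp.single_apply_ne _ _ _ hk.symm, mul_zero])
  refine (h1.unique h2).trans ?_
  change c n * ((lp.single 2 n (y n) : Ell2) : ℤ → ℂ) n = _
  rw [lp.single_apply_self]

/-- A norm limit of finite rank operators. For a non-summable `c` the `tsum` takes its default value
0, which is compact too. -/
theorem isCompactOperator_diag (c : ℤ → ℂ) : IsCompactOperator (diag c) := by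
  have hcl : IsClosed (compactOperator (RingHom.id ℂ) Ell2 Ell2 : Set (Ell2 →L[ℂ] Ell2)) :=
    isClosed_setOfPred_isCompactOperator
  have h : diag c ∈ compactOperator (RingHom.id ℂ) Ell2 Ell2 := by
    refine tsum_mem hcl fun n => Submodule.smul_mem _ _ ?_
    exact (isCompactOperator_of_locallyCompactSpace_rng (M₂ := ℂ)
      (lp.singleContinuousLinearMap ℂ (fun _ : ℤ => ℂ) 2 n)).comp_clm _
  exact h

/-! ### The pencil as a compact perturbation of the free pencil -/

variable {a p q : ℤ → ℂ}

/-- The sum of the zero order coefficients of the perturbation. -/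
theorem Decaying.summable_potential (h : Decaying a p q) (l : ℂ) :
    Summable fun n => ‖q n + (1 - a n) + (1 - a (n - 1)) + 2 * l * p n‖ := by
  have h1 : Summable fun n => ‖1 - a (n - 1)‖ := h.summable_a.comp_injective (sub_left_injective (b := (1 : ℤ)))
  have h2 := ((h.summable_q.add h.summable_a).add h1).add (h.summable_p.mul_left ‖2 * l‖)
  refine Summable.of_norm_bounded h2 fun n => ?_
  rw [norm_norm]
  refine (norm_add_le _ _).trans (add_le_add ((norm_add_le _ _).trans
    (add_le_add (norm_add_le _ _) le_rfl)) (norm_mul _ _).le)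

/-- The compact difference between the pencil and the pencil with `a = 1`, `p = q = 0`. -/
def perturbation (a p q : ℤ → ℂ) (l : ℂ) : Ell2 →L[ℂ] Ell2 :=
  (diag fun n => a n - 1).comp (shift 1).toContinuousLinearMap +
    (diag fun n => a (n - 1) - 1).comp (shift (-1)).toContinuousLinearMap +
    diag fun n => q n + (1 - a n) + (1 - a (n - 1)) + 2 * l * p n

/-- The pencil with `a = 1`, `p = q = 0`. -/
def freePencil (l : ℂ) : Ell2 →L[ℂ] Ell2 :=
  (shift 1).toContinuousLinearMap + (shift (-1)).toContinuousLinearMap + (l ^ 2 - 2) • 1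

theorem isCompactOperator_perturbation (l : ℂ) : IsCompactOperator (perturbation a p q l) :=
  (((isCompactOperator_diag _).comp_clm _).add ((isCompactOperator_diag _).comp_clm _)).add
    (isCompactOperator_diag _)

theorem Decaying.freePencil_add_perturbation_apply (h : Decaying a p q) (l : ℂ) (y : Ell2) :
    (((freePencil l + perturbation a p q l) y : Ell2) : ℤ → ℂ) = expr a p q l y := by
  funext n
  have h0 : Summable fun n => ‖a n - 1‖ := by simpa only [norm_sub_rev] using h.summable_a
  have h1 : Summable fun n => ‖a (n - 1) - 1‖ := h0.comp_injective (sub_left_injective (b := (1 : ℤ)))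
  have e1 : freePencil l y n = y (n + 1) + y (n - 1) + (l ^ 2 - 2) * y n := rfl
  have e2 : perturbation a p q l y n = (a n - 1) * y (n + 1) + (a (n - 1) - 1) * y (n - 1)
      + (q n + (1 - a n) + (1 - a (n - 1)) + 2 * l * p n) * y n := by
    change diag _ (shift 1 y) n + diag _ (shift (-1) y) n + diag _ y n = _
    rw [diag_apply h0, diag_apply h1, diag_apply (h.summable_potential l)]
    rfl
  change freePencil l y n + perturbation a p q l y n = _
  rw [e1, e2, expr_apply]
  ring

theorem Decaying.mem_domain (h : Decaying a p q) (l : ℂ) (y : Ell2) :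
    y ∈ (pencil a p q l).domain := by
  change Memℓp (expr a p q l (y : ℤ → ℂ)) 2
  rw [← h.freePencil_add_perturbation_apply]
  exact lp.memℓp _

/-- Injectivity of the pencil, in terms of square summable solutions. -/
theorem injective_pencil_iff (h : Decaying a p q) (l : ℂ) :
    Function.Injective (pencil a p q l) ↔
      ∀ y : ℤ → ℂ, Memℓp y 2 → (∀ n, expr a p q l y n = 0) → y = 0 := by
  constructor
  · intro hi y hy hy0
    have h1 : pencil a p q l ⟨⟨y, hy⟩, h.mem_domain l _⟩ = pencil a p q l 0 := by
      rw [LinearPMap.map_zero]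
      exact lp.ext (funext hy0)
    have h2 := congrArg (fun v : (pencil a p q l).domain => ((v : Ell2) : ℤ → ℂ)) (hi h1)
    exact h2
  · intro hi y w hyw
    have h1 : ((y - w : (pencil a p q l).domain) : Ell2) = 0 := by
      refine lp.ext (hi _ (lp.memℓp _) fun n => ?_)
      have h2 : pencil a p q l (y - w) = 0 := by rw [LinearPMap.map_sub, hyw, sub_self]
      exact congrFun (congrArg (fun v : Ell2 => (v : ℤ → ℂ)) h2) n
    exact sub_eq_zero.1 (Submodule.coe_eq_zero.1 h1)

theorem two_mul_cos_half_sq (z : ℂ) : (2 * Complex.cos (z / 2)) ^ 2 =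
    2 + Complex.exp (Complex.I * z) + Complex.exp (-(Complex.I * z)) := by
  have h : Complex.cos z = 2 * Complex.cos (z / 2) ^ 2 - 1 := by
    rw [← Complex.cos_two_mul]; ring_nf
  have h2 := Complex.two_cos z
  rw [h] at h2
  have e1 : z * Complex.I = Complex.I * z := mul_comm _ _
  have e2 : -z * Complex.I = -(Complex.I * z) := by ring
  rw [e1, e2] at h2
  linear_combination h2

theorem norm_exp_I_mul (z : ℂ) : ‖Complex.exp (Complex.I * z)‖ = Real.exp (-z.im) := by
  rw [Complex.norm_exp]; simp

theorem isUnit_one_add_smul {T : Ell2 →L[ℂ] Ell2} (hT : ‖T‖ ≤ 1) {w : ℂ} (hw : ‖w‖ < 1) :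
    IsUnit (1 + w • T) := by
  have h := isUnit_one_sub_of_norm_lt_one (x := (-w) • T) (by
    rw [norm_smul, norm_neg]
    nlinarith [norm_nonneg w, norm_nonneg T])
  simpa [sub_eq_add_neg] using h

/-- With w = e^{iz} and S the translation, S + S⁻¹ + w + w⁻¹ = w⁻¹ (1 + wS)(1 + wS⁻¹). Both factors
are inverted by Neumann series because |w| < 1. -/
theorem isUnit_freePencil {z : ℂ} (hz : 0 < z.im) :
    IsUnit (freePencil (2 * Complex.cos (z / 2))) := by
  set w := Complex.exp (Complex.I * z) with hw
  have hw0 : w ≠ 0 := Complex.exp_ne_zero _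
  have hw1 : ‖w‖ < 1 := by rw [hw, norm_exp_I_mul]; simpa using hz
  have hfac : freePencil (2 * Complex.cos (z / 2)) = w⁻¹ •
      ((1 + w • (shift 1).toContinuousLinearMap) *
        (1 + w • (shift (-1)).toContinuousLinearMap)) := by
    have hl : (2 * Complex.cos (z / 2)) ^ 2 - 2 = w + w⁻¹ := by
      rw [two_mul_cos_half_sq, hw, Complex.exp_neg]; ring
    ext y n
    change (y (n + 1) + y (n + -1) + ((2 * Complex.cos (z / 2)) ^ 2 - 2) * y n : ℂ) =
      w⁻¹ * ((y n + w * y (n + -1)) + w * (y (n + 1) + w * y (n + 1 + -1)))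
    rw [hl]
    have : n + 1 + -1 = n := by ring
    rw [this]
    field_simp
    ring
  rw [hfac]
  have h1 := (isUnit_one_add_smul (LinearIsometry.norm_toContinuousLinearMap_le (shift 1)) hw1).mul
    (isUnit_one_add_smul (LinearIsometry.norm_toContinuousLinearMap_le (shift (-1))) hw1)
  have := h1.smul (Units.mk0 w⁻¹ (inv_ne_zero hw0))
  exact this

/-- Off the segment `[-2, 2]` an injective pencil is boundedly invertible. -/
theorem Decaying.mem_resolventSet_of_injective (h : Decaying a p q) {z : ℂ} (hz : 0 < z.im)
    (hi : Function.Injective (pencil a p q (2 * Complex.cos (z / 2)))) :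
    2 * Complex.cos (z / 2) ∈ resolventSet a p q := by
  set l := 2 * Complex.cos (z / 2) with hl
  rw [injective_pencil_iff h] at hi
  obtain ⟨u, hu⟩ := isUnit_freePencil hz
  have hu' : (u : Ell2 →L[ℂ] Ell2) = freePencil l := hu
  set T : Ell2 →L[ℂ] Ell2 := (↑u⁻¹ : Ell2 →L[ℂ] Ell2) * perturbation a p q l with hT
  have hTc : IsCompactOperator T := (isCompactOperator_perturbation l).clm_comp _
  have hfac : freePencil l + perturbation a p q l = u * (1 + T) := by
    rw [hT, mul_add, mul_one, ← mul_assoc, Units.mul_inv, one_mul, hu']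
  have hunit : IsUnit (freePencil l + perturbation a p q l) := by
    rw [hfac]
    refine u.isUnit.mul ?_
    -- Fredholm alternative: if 1 + T is not invertible, then -1 is an eigenvalue of T, and an
    -- eigenvector is a square summable solution.
    rcases hTc.hasEigenvalue_or_mem_resolventSet (μ := -1) (by norm_num) with he | hr
    · exfalso
      obtain ⟨v, hv⟩ := he.exists_hasEigenvector
      have hv1 : T v = (-1 : ℂ) • v := hv.apply_eq_smul
      refine hv.2 (lp.ext (hi v (lp.memℓp _) fun n => ?_))
      rw [← h.freePencil_add_perturbation_apply, hfac]
      have : (1 + T) v = 0 := by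
        change v + T v = 0
        rw [hv1]; simp
      change ((u : Ell2 →L[ℂ] Ell2) ((1 + T) v)) n = 0
      rw [this, map_zero]; rfl
    · have h1 : IsUnit (algebraMap ℂ (Ell2 →L[ℂ] Ell2) (-1) - T) := hr
      have h2 : algebraMap ℂ (Ell2 →L[ℂ] Ell2) (-1) - T = -(1 + T) := by
        rw [map_neg, map_one]; abel
      rw [h2] at h1
      exact (IsUnit.neg_iff _).1 h1
  obtain ⟨w, hw⟩ := hunit
  refine ⟨(↑w⁻¹ : Ell2 →L[ℂ] Ell2), fun φ => ⟨h.mem_domain l _, ?_⟩, fun y => ?_⟩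
  · refine lp.ext ?_
    change expr a p q l _ = _
    rw [← h.freePencil_add_perturbation_apply, ← hw]
    change ((((w : Ell2 →L[ℂ] Ell2) * (↑w⁻¹ : Ell2 →L[ℂ] Ell2)) φ : Ell2) : ℤ → ℂ) = _
    rw [Units.mul_inv]; rfl
  · have h1 : pencil a p q l y = (w : Ell2 →L[ℂ] Ell2) y := by
      refine lp.ext ?_
      rw [hw, h.freePencil_add_perturbation_apply]
      rfl
    rw [h1]
    change ((↑w⁻¹ : Ell2 →L[ℂ] Ell2) * (w : Ell2 →L[ℂ] Ell2)) (y : Ell2) = _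
    rw [Units.inv_mul]; rfl


/-! ### Backward iteration of a summable perturbation of contractions -/

section Iteration

variable {V : Type*} [MetricSpace V]

/-- `T n (T (n + 1) (⋯ (T (n + j - 1) v)))`. -/
def backIter (T : ℤ → V → V) (v : V) : ℤ → ℕ → V
  | _, 0 => v
  | n, j + 1 => T n (backIter T v (n + 1) j)

/-- The iterates of lengths j and j + 1 differ only in the innermost entry, `v` against `T (n + j)
v`. The outer maps enlarge this difference by at most ∏ (1 + ε) ≤ exp ∑ ε. -/
theorem dist_backIter_succ_le {T : ℤ → V → V} {v : V} {ε : ℤ → ℝ}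
    (hT : ∀ n u w, dist (T n u) (T n w) ≤ (1 + ε n) * dist u w)
    (hv : ∀ n, dist (T n v) v ≤ ε n) (j : ℕ) (n : ℤ) :
    dist (backIter T v n j) (backIter T v n (j + 1)) ≤
      Real.exp (∑ i ∈ Finset.range j, ε (n + i)) * ε (n + j) := by
  induction j generalizing n with
  | zero => simpa [backIter, dist_comm] using hv n
  | succ j ih =>
    calc dist (backIter T v n (j + 1)) (backIter T v n (j + 2))
        ≤ (1 + ε n) * dist (backIter T v (n + 1) j) (backIter T v (n + 1) (j + 1)) := hT _ _ _
      _ ≤ Real.exp (ε n) *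
          (Real.exp (∑ i ∈ Finset.range j, ε (n + 1 + i)) * ε (n + 1 + j)) := by
        gcongr
        · linarith [Real.add_one_le_exp (ε n)]
        · exact ih (n + 1)
      _ = _ := by
        rw [← mul_assoc, ← Real.exp_add, Finset.sum_range_succ']
        push_cast
        have h1 : ∀ i : ℕ, n + ((i : ℤ) + 1) = n + 1 + i := fun i => by ring
        simp only [h1, add_zero]
        rw [add_comm (ε n)]

theorem dist_backIter_succ_le_tsum {T : ℤ → V → V} {v : V} {ε : ℤ → ℝ} (hε : ∀ n, 0 ≤ ε n)
    (hs : Summable ε) (hT : ∀ n u w, dist (T n u) (T n w) ≤ (1 + ε n) * dist u w)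
    (hv : ∀ n, dist (T n v) v ≤ ε n) (j : ℕ) (n : ℤ) :
    dist (backIter T v n j) (backIter T v n (j + 1)) ≤ Real.exp (∑' k, ε k) * ε (n + j) := by
  refine (dist_backIter_succ_le hT hv j n).trans ?_
  refine mul_le_mul_of_nonneg_right (Real.exp_le_exp.2 ?_) (hε _)
  have hinj : Function.Injective fun i : ℕ => n + (i : ℤ) := fun i k h => by simpa using h
  rw [← Finset.sum_image (f := ε) (g := fun i : ℕ => n + (i : ℤ)) hinj.injOn]
  exact hs.sum_le_tsum _ fun i _ => hε i

theorem summable_tail {ε : ℤ → ℝ} (hs : Summable ε) (C : ℝ) (n : ℤ) :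
    Summable fun j : ℕ => C * ε (n + j) :=
  (hs.comp_injective (i := fun i : ℕ => n + (i : ℤ)) fun i k h => by simpa using h).mul_left C

variable [CompleteSpace V]

/-- The limit of `backIter T v n j` as `j → ∞`. -/
def backLim [Nonempty V] (T : ℤ → V → V) (v : V) (n : ℤ) : V := limUnder atTop (backIter T v n)

variable [Nonempty V]

theorem tendsto_backIter {T : ℤ → V → V} {v : V} {ε : ℤ → ℝ} (hε : ∀ n, 0 ≤ ε n)
    (hs : Summable ε) (hT : ∀ n u w, dist (T n u) (T n w) ≤ (1 + ε n) * dist u w)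
    (hv : ∀ n, dist (T n v) v ≤ ε n) (n : ℤ) :
    Tendsto (backIter T v n) atTop (𝓝 (backLim T v n)) :=
  tendsto_nhds_limUnder <| cauchySeq_tendsto_of_complete (cauchySeq_of_dist_le_of_summable _
    (fun j => dist_backIter_succ_le_tsum hε hs hT hv j n) (summable_tail hs _ n))

/-- The bound involves `T` only through `ε`, so convergence is uniform over any family of maps
sharing the same `ε`. -/
theorem dist_backIter_backLim_le {T : ℤ → V → V} {v : V} {ε : ℤ → ℝ} (hε : ∀ n, 0 ≤ ε n)
    (hs : Summable ε) (hT : ∀ n u w, dist (T n u) (T n w) ≤ (1 + ε n) * dist u w)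
    (hv : ∀ n, dist (T n v) v ≤ ε n) (n : ℤ) (j : ℕ) :
    dist (backIter T v n j) (backLim T v n) ≤
      ∑' m : ℕ, Real.exp (∑' k, ε k) * ε (n + ((j + m : ℕ) : ℤ)) :=
  dist_le_tsum_of_dist_le_of_tendsto _ (fun j => dist_backIter_succ_le_tsum hε hs hT hv j n)
    (summable_tail hs _ n) (tendsto_backIter hε hs hT hv n) j

theorem backLim_eq {T : ℤ → V → V} {v : V} {ε : ℤ → ℝ} (hε : ∀ n, 0 ≤ ε n)
    (hs : Summable ε) (hT : ∀ n u w, dist (T n u) (T n w) ≤ (1 + ε n) * dist u w)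
    (hv : ∀ n, dist (T n v) v ≤ ε n) (n : ℤ) :
    backLim T v n = T n (backLim T v (n + 1)) := by
  have h1 := (tendsto_add_atTop_iff_nat 1).2 (tendsto_backIter hε hs hT hv n)
  have hc : Continuous (T n) := by
    have : LipschitzWith (Real.toNNReal (1 + ε n)) (T n) := LipschitzWith.of_dist_le_mul fun u w => by
      rw [Real.coe_toNNReal _ (by linarith [hε n])]
      exact hT n u w
    exact this.continuous
  have h2 := (hc.tendsto _).comp (tendsto_backIter hε hs hT hv (n + 1))
  exact tendsto_nhds_unique h1 h2

theorem tendsto_tsum_tail {ε : ℤ → ℝ} (C : ℝ) :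
    Tendsto (fun n : ℤ => ∑' m : ℕ, C * ε (n + m)) atTop (𝓝 0) := by
  rw [← Nat.map_cast_int_atTop, tendsto_map'_iff]
  have h := tendsto_sum_nat_add fun k : ℕ => C * ε k
  refine h.congr fun n => tsum_congr fun m => ?_
  push_cast
  rw [add_comm]

theorem tendsto_backLim {T : ℤ → V → V} {v : V} {ε : ℤ → ℝ} (hε : ∀ n, 0 ≤ ε n)
    (hs : Summable ε) (hT : ∀ n u w, dist (T n u) (T n w) ≤ (1 + ε n) * dist u w)
    (hv : ∀ n, dist (T n v) v ≤ ε n) : Tendsto (backLim T v) atTop (𝓝 v) := by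
  rw [tendsto_iff_dist_tendsto_zero]
  refine squeeze_zero (fun _ => dist_nonneg) (fun n => ?_)
    (tendsto_tsum_tail (ε := ε) (Real.exp (∑' k, ε k)))
  rw [dist_comm]
  have := dist_backIter_backLim_le hε hs hT hv n 0
  simpa [backIter] using this

end Iteration

/-! ### The Jost solutions -/

variable (a p q)

/-- `e^{iz}`. -/
def zeta (z : ℂ) : ℂ := Complex.exp (Complex.I * z)

/-- Coefficient diagonalizing the unperturbed first order system. -/
def mixing (z : ℂ) : ℂ := zeta z ^ 2 / (1 - zeta z ^ 2)

/-- The potential of the equation for `(-1)^n e^{-inz} y_n`. -/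
def jostCoeff (z : ℂ) (n : ℤ) : ℂ :=
  zeta z * (q n + 2 * (2 * Complex.cos (z / 2)) * p n) + (zeta z + zeta z ^ 2) * (1 - a n)
    + (1 + zeta z) * (1 - a (n - 1))

/-- One backward step of the diagonalized first order system. -/
def jostStep (z : ℂ) (n : ℤ) (v : ℂ × ℂ) : ℂ × ℂ :=
  (v.1 + (1 + mixing z) * (jostCoeff a p q z (n + 1) * (v.1 + mixing z * v.2))
      - ((a n)⁻¹ - 1) * (zeta z ^ 2 * v.2 - jostCoeff a p q z (n + 1) * (v.1 + mixing z * v.2)),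
    zeta z ^ 2 * v.2 - jostCoeff a p q z (n + 1) * (v.1 + mixing z * v.2))

/-- The limiting vector of the diagonalized first order system. -/
def jostVec (z : ℂ) (n : ℤ) : ℂ × ℂ := backLim (jostStep a p q z) (1, 0) n

/-- The Jost solution at `+∞`, constructed by backward iteration. -/
def jostSol (z : ℂ) (n : ℤ) : ℂ :=
  (-1) ^ n * zeta z ^ n * ((jostVec a p q z n).1 + mixing z * (jostVec a p q z n).2)

/-- Summable bound for the perturbation, when `|cos (z / 2)| ≤ B` and `|mixing z| ≤ X`. -/
def jostBound (B X A : ℝ) (n : ℤ) : ℝ :=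
  ((1 + X) ^ 2 + A * (1 + X)) * (‖q (n + 1)‖ + 4 * B * ‖p (n + 1)‖ + 2 * ‖1 - a (n + 1)‖
    + 2 * ‖1 - a n‖) + ‖(a n)⁻¹ - 1‖

/-- The set of `z` in the closed upper half plane with `e^{2iz} ≠ 1`. -/
def jostDomain : Set ℂ := {z | 0 ≤ z.im ∧ zeta z ^ 2 ≠ 1}

variable {a p q}

theorem zeta_ne_zero (z : ℂ) : zeta z ≠ 0 := Complex.exp_ne_zero _

theorem norm_zeta (z : ℂ) : ‖zeta z‖ = Real.exp (-z.im) := norm_exp_I_mul z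

theorem norm_zeta_le_one {z : ℂ} (hz : 0 ≤ z.im) : ‖zeta z‖ ≤ 1 := by
  rw [norm_zeta]; simpa using hz

theorem zeta_zpow (z : ℂ) (n : ℤ) : zeta z ^ n = Complex.exp (Complex.I * n * z) := by
  rw [zeta, ← Complex.exp_int_mul]
  ring_nf

theorem norm_jostCoeff_le {z : ℂ} (hz : 0 ≤ z.im) {B : ℝ} (hB : ‖Complex.cos (z / 2)‖ ≤ B)
    (n : ℤ) : ‖jostCoeff a p q z n‖ ≤
      ‖q n‖ + 4 * B * ‖p n‖ + 2 * ‖1 - a n‖ + 2 * ‖1 - a (n - 1)‖ := by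
  have h1 := norm_zeta_le_one hz
  have h2 : ‖zeta z ^ 2‖ ≤ 1 := by rw [norm_pow]; exact pow_le_one₀ (norm_nonneg _) h1
  unfold jostCoeff
  refine (norm_add_le _ _).trans (add_le_add ((norm_add_le _ _).trans (add_le_add ?_ ?_)) ?_)
  · rw [norm_mul]
    refine (mul_le_of_le_one_left (norm_nonneg _) h1).trans ((norm_add_le _ _).trans ?_)
    rw [norm_mul, norm_mul, norm_mul]
    simp only [Complex.norm_ofNat]
    exact add_le_add le_rfl (mul_le_mul_of_nonneg_right (by linarith) (norm_nonneg _))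
  · rw [norm_mul]
    gcongr
    exact (norm_add_le _ _).trans (by linarith)
  · rw [norm_mul]
    gcongr
    exact (norm_add_le _ _).trans (by rw [norm_one]; linarith)

theorem Decaying.tendsto_cofinite (h : Decaying a p q) : Tendsto a cofinite (𝓝 1) := by
  rw [tendsto_iff_norm_sub_tendsto_zero]
  simpa only [norm_sub_rev] using h.summable_a.tendsto_cofinite_zero

theorem Decaying.summable_inv (h : Decaying a p q) : Summable fun n => ‖(a n)⁻¹ - 1‖ := by
  have h1 : Tendsto (fun n => ‖a n‖) cofinite (𝓝 1) := by simpa using h.tendsto_cofinite.norm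
  refine Summable.of_norm_bounded_eventually (h.summable_a.mul_left 2) ?_
  filter_upwards [h1.eventually (lt_mem_nhds (by norm_num : (1 / 2 : ℝ) < 1))] with n hn
  have e : (a n)⁻¹ - 1 = (a n)⁻¹ * (1 - a n) := by
    rw [mul_sub, mul_one, inv_mul_cancel₀ (h.ne_zero n)]
  rw [norm_norm, e, norm_mul, norm_inv]
  gcongr
  rw [inv_le_comm₀ (by linarith) (by norm_num)]
  linarith

theorem Decaying.exists_inv_bound (h : Decaying a p q) : ∃ A : ℝ, ∀ n, ‖(a n)⁻¹ - 1‖ ≤ A :=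
  ⟨_, fun n => h.summable_inv.le_tsum n fun _ _ => norm_nonneg _⟩

theorem Decaying.summable_jostBound (h : Decaying a p q) (B X A : ℝ) :
    Summable (jostBound a p q B X A) := by
  have hi := add_left_injective (1 : ℤ)
  exact (((((h.summable_q.comp_injective hi).add ((h.summable_p.comp_injective hi).mul_left _)).add
    ((h.summable_a.comp_injective hi).mul_left _)).add (h.summable_a.mul_left _)).mul_left _).add
      h.summable_inv

theorem jostBound_nonneg {B X A : ℝ} (hB : 0 ≤ B) (hX : 0 ≤ X) (hA : 0 ≤ A) (n : ℤ) :
    0 ≤ jostBound a p q B X A n := by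
  unfold jostBound
  positivity

/-- The unperturbed step is diag(1, ζ²), which does not increase the sup norm when Im z ≥ 0.
Everything else carries a factor `jostCoeff` or (a n)⁻¹ - 1, and both are summable. -/
theorem norm_jostStep_sub_le {z : ℂ} (hz : 0 ≤ z.im) {B X A : ℝ}
    (hB : ‖Complex.cos (z / 2)‖ ≤ B) (hX : ‖mixing z‖ ≤ X) (hA : ∀ n, ‖(a n)⁻¹ - 1‖ ≤ A)
    (n : ℤ) (v : ℂ × ℂ) :
    ‖jostStep a p q z n v - (v.1, zeta z ^ 2 * v.2)‖ ≤ jostBound a p q B X A n * ‖v‖ := by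
  have hs := norm_jostCoeff_le (a := a) (p := p) (q := q) hz hB (n + 1)
  rw [add_sub_cancel_right] at hs
  set σ := ‖q (n + 1)‖ + 4 * B * ‖p (n + 1)‖ + 2 * ‖1 - a (n + 1)‖ + 2 * ‖1 - a n‖ with hσ
  set s := jostCoeff a p q z (n + 1)
  set x := mixing z
  have hX0 : 0 ≤ X := (norm_nonneg _).trans hX
  have hA0 : 0 ≤ A := (norm_nonneg _).trans (hA n)
  have hσ0 : 0 ≤ σ := (norm_nonneg _).trans hs
  have h1 : ‖v.1‖ ≤ ‖v‖ := norm_fst_le v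
  have h2 : ‖v.2‖ ≤ ‖v‖ := norm_snd_le v
  have hz2 : ‖zeta z ^ 2‖ ≤ 1 := by
    rw [norm_pow]; exact pow_le_one₀ (norm_nonneg _) (norm_zeta_le_one hz)
  have hg : ‖v.1 + x * v.2‖ ≤ (1 + X) * ‖v‖ := by
    refine (norm_add_le _ _).trans ?_
    rw [norm_mul, add_mul, one_mul]
    gcongr
  have hsg : ‖s * (v.1 + x * v.2)‖ ≤ σ * ((1 + X) * ‖v‖) := by
    rw [norm_mul]; gcongr
  have hd : ‖zeta z ^ 2 * v.2‖ ≤ ‖v‖ := by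
    rw [norm_mul]; exact (mul_le_of_le_one_left (norm_nonneg _) hz2).trans h2
  have hx1 : ‖1 + x‖ ≤ 1 + X := (norm_add_le _ _).trans (by rw [norm_one]; gcongr)
  have hb : jostBound a p q B X A n * ‖v‖ =
      ((1 + X) * (σ * ((1 + X) * ‖v‖)) + A * (σ * ((1 + X) * ‖v‖))) + ‖(a n)⁻¹ - 1‖ * ‖v‖ := by
    rw [jostBound, ← hσ]; ring
  have e1 : (jostStep a p q z n v - (v.1, zeta z ^ 2 * v.2)).1 =
      (1 + x) * (s * (v.1 + x * v.2)) + ((a n)⁻¹ - 1) * (s * (v.1 + x * v.2))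
        - ((a n)⁻¹ - 1) * (zeta z ^ 2 * v.2) := by
    simp only [jostStep, Prod.fst_sub]; ring
  have e2 : (jostStep a p q z n v - (v.1, zeta z ^ 2 * v.2)).2 = -(s * (v.1 + x * v.2)) := by
    simp only [jostStep, Prod.snd_sub]; ring
  rw [hb]
  refine norm_prod_le_iff.2 ⟨?_, ?_⟩
  · rw [e1]
    refine (norm_sub_le _ _).trans (add_le_add ((norm_add_le _ _).trans (add_le_add ?_ ?_)) ?_)
    · rw [norm_mul]; gcongr
    · rw [norm_mul]; gcongr; exact hA n
    · rw [norm_mul]; gcongr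
  · rw [e2, norm_neg]
    have h3 : 0 ≤ σ * ((1 + X) * ‖v‖) := by positivity
    have h4 : 0 ≤ X * (σ * ((1 + X) * ‖v‖)) := by positivity
    have h5 : 0 ≤ A * (σ * ((1 + X) * ‖v‖)) := by positivity
    have h6 : 0 ≤ ‖(a n)⁻¹ - 1‖ * ‖v‖ := by positivity
    linarith

theorem jostStep_sub (z : ℂ) (n : ℤ) (u w : ℂ × ℂ) :
    jostStep a p q z n u - jostStep a p q z n w = jostStep a p q z n (u - w) := by
  ext
  · simp only [jostStep, Prod.fst_sub, Prod.snd_sub]; ring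
  · simp only [jostStep, Prod.fst_sub, Prod.snd_sub]; ring

theorem dist_jostStep_le {z : ℂ} (hz : 0 ≤ z.im) {B X A : ℝ}
    (hB : ‖Complex.cos (z / 2)‖ ≤ B) (hX : ‖mixing z‖ ≤ X) (hA : ∀ n, ‖(a n)⁻¹ - 1‖ ≤ A)
    (n : ℤ) (u w : ℂ × ℂ) :
    dist (jostStep a p q z n u) (jostStep a p q z n w) ≤
      (1 + jostBound a p q B X A n) * dist u w := by
  rw [dist_eq_norm, dist_eq_norm, jostStep_sub]
  set v := u - w
  have h1 := norm_jostStep_sub_le (p := p) (q := q) hz hB hX hA n v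
  have h2 : ‖(v.1, zeta z ^ 2 * v.2)‖ ≤ ‖v‖ := by
    refine norm_prod_le_iff.2 ⟨norm_fst_le v, ?_⟩
    rw [norm_mul, norm_pow]
    exact (mul_le_of_le_one_left (norm_nonneg _)
      (pow_le_one₀ (norm_nonneg _) (norm_zeta_le_one hz))).trans (norm_snd_le v)
  have h3 := norm_add_le (jostStep a p q z n v - (v.1, zeta z ^ 2 * v.2)) (v.1, zeta z ^ 2 * v.2)
  rw [sub_add_cancel] at h3
  linarith

theorem dist_jostStep_unit_le {z : ℂ} (hz : 0 ≤ z.im) {B X A : ℝ}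
    (hB : ‖Complex.cos (z / 2)‖ ≤ B) (hX : ‖mixing z‖ ≤ X) (hA : ∀ n, ‖(a n)⁻¹ - 1‖ ≤ A)
    (n : ℤ) : dist (jostStep a p q z n (1, 0)) (1, 0) ≤ jostBound a p q B X A n := by
  have h1 := norm_jostStep_sub_le (p := p) (q := q) hz hB hX hA n (1, 0)
  rw [dist_eq_norm]
  simpa using h1

theorem Decaying.jostVec_eq (h : Decaying a p q) {z : ℂ} (hz : 0 ≤ z.im) (n : ℤ) :
    jostVec a p q z n = jostStep a p q z n (jostVec a p q z (n + 1)) := by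
  obtain ⟨A, hA⟩ := h.exists_inv_bound
  exact backLim_eq (jostBound_nonneg (norm_nonneg _) (norm_nonneg _) ((norm_nonneg _).trans (hA 0)))
    (h.summable_jostBound ‖Complex.cos (z / 2)‖ ‖mixing z‖ A)
    (dist_jostStep_le hz le_rfl le_rfl hA) (dist_jostStep_unit_le hz le_rfl le_rfl hA) n

theorem Decaying.tendsto_jostVec (h : Decaying a p q) {z : ℂ} (hz : 0 ≤ z.im) :
    Tendsto (jostVec a p q z) atTop (𝓝 (1, 0)) := by
  obtain ⟨A, hA⟩ := h.exists_inv_bound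
  exact tendsto_backLim
    (jostBound_nonneg (norm_nonneg _) (norm_nonneg _) ((norm_nonneg _).trans (hA 0)))
    (h.summable_jostBound ‖Complex.cos (z / 2)‖ ‖mixing z‖ A)
    (dist_jostStep_le hz le_rfl le_rfl hA) (dist_jostStep_unit_le hz le_rfl le_rfl hA)

theorem neg_one_zpow_mul_self (n : ℤ) : ((-1 : ℂ) ^ n) * (-1) ^ n = 1 := by
  rw [← mul_zpow]; simp

/-- Write y_n = (-1)^n ζ^n g_n and d_n = a_n (g_{n+1} - g_n). The equation becomes d_{n-1} = ζ² d_n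
- s_n g_n with s = `jostCoeff`. The vector iterated is (g_n - x d_n, d_n) with x = `mixing z`. It
tends to (1, 0), so g_n → 1. -/
theorem Decaying.isJostPlus_jostSol (h : Decaying a p q) {z : ℂ} (hz : z ∈ jostDomain) :
    IsJostPlus a p q z (jostSol a p q z) := by
  obtain ⟨hz0, hz1⟩ := hz
  have hw := zeta_ne_zero z
  have hden : 1 - zeta z ^ 2 ≠ 0 := sub_ne_zero.2 (Ne.symm hz1)
  have hx : mixing z * (1 - zeta z ^ 2) = zeta z ^ 2 := div_mul_cancel₀ _ hden
  constructor
  · intro n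
    have hl : (2 * Complex.cos (z / 2)) ^ 2 = 2 + zeta z + (zeta z)⁻¹ := by
      rw [two_mul_cos_half_sq, Complex.exp_neg]; rfl
    -- The second component is d_m. This uses x (1 - ζ²) = ζ², the choice of x that decouples the
    -- unperturbed system.
    have key : ∀ m, a m * (((jostVec a p q z (m + 1)).1 + mixing z * (jostVec a p q z (m + 1)).2)
        - ((jostVec a p q z m).1 + mixing z * (jostVec a p q z m).2)) = (jostVec a p q z m).2 := by
      intro m
      have h1 := congrArg Prod.fst (h.jostVec_eq hz0 m)
      have h2 := congrArg Prod.snd (h.jostVec_eq hz0 m)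
      simp only [jostStep] at h1 h2
      rw [← h2] at h1
      have ha := mul_inv_cancel₀ (h.ne_zero m)
      linear_combination (-(a m)) * h1 + (jostVec a p q z m).2 * ha
        - a m * (1 + mixing z) * h2 + a m * (jostVec a p q z (m + 1)).2 * hx
    have k0 := key n
    have k1 := key (n - 1)
    have h2 := congrArg Prod.snd (h.jostVec_eq hz0 (n - 1))
    simp only [jostStep, jostCoeff, sub_add_cancel] at h2
    rw [sub_add_cancel] at k1
    rw [expr_apply]
    simp only [jostSol]
    rw [zpow_add₀ hw, zpow_sub₀ hw, zpow_add₀ (by norm_num : (-1 : ℂ) ≠ 0),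
      zpow_sub₀ (by norm_num : (-1 : ℂ) ≠ 0), zpow_one, zpow_one, hl]
    generalize (jostVec a p q z (n + 1)).1 + mixing z * (jostVec a p q z (n + 1)).2 = g1 at *
    generalize (jostVec a p q z (n - 1)).1 + mixing z * (jostVec a p q z (n - 1)).2 = g0 at *
    generalize (jostVec a p q z n).1 + mixing z * (jostVec a p q z n).2 = g at *
    -- Now `h2` is the recursion for d in terms of g alone: the difference equation up to a nonzero
    -- factor.
    rw [← k0, ← k1] at h2
    field_simp
    linear_combination ((-1) ^ n * zeta z ^ n) * h2
  · have h1 := h.tendsto_jostVec hz0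
    have h2 : Tendsto (fun n => (jostVec a p q z n).1 + mixing z * (jostVec a p q z n).2) atTop
        (𝓝 (1 + mixing z * 0)) :=
      ((continuous_fst.tendsto _).comp h1).add
        (tendsto_const_nhds.mul ((continuous_snd.tendsto _).comp h1))
    rw [mul_zero, add_zero] at h2
    refine h2.congr fun n => ?_
    have e : Complex.exp (-(Complex.I * n * z)) * zeta z ^ n = 1 := by
      rw [zeta_zpow, ← Complex.exp_add, neg_add_cancel, Complex.exp_zero]
    rw [jostSol]
    linear_combination (-((jostVec a p q z n).1 + mixing z * (jostVec a p q z n).2)) *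
      (Complex.exp (-(Complex.I * n * z)) * zeta z ^ n * neg_one_zpow_mul_self n + e)

theorem differentiable_zeta : Differentiable ℂ zeta :=
  Complex.differentiable_exp.comp (differentiable_id.const_mul Complex.I)

theorem differentiableAt_mixing {z : ℂ} (hz : zeta z ^ 2 ≠ 1) : DifferentiableAt ℂ mixing z :=
  (differentiable_zeta.differentiableAt.pow 2).div
    ((differentiableAt_const 1).sub (differentiable_zeta.differentiableAt.pow 2))
    (sub_ne_zero.2 (Ne.symm hz))

theorem differentiable_jostCoeff (n : ℤ) : Differentiable ℂ fun z => jostCoeff a p q z n := by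
  have := differentiable_zeta
  unfold jostCoeff
  fun_prop

theorem differentiableAt_jostIter {z : ℂ} (hz : zeta z ^ 2 ≠ 1) (j : ℕ) (n : ℤ) :
    DifferentiableAt ℂ (fun w => backIter (jostStep a p q w) (1, 0) n j) z := by
  induction j generalizing n with
  | zero => exact differentiableAt_const _
  | succ j ih =>
    have h1 := differentiableAt_mixing hz
    have h2 := differentiable_zeta z
    have h3 := differentiable_jostCoeff (a := a) (p := p) (q := q) (n + 1) z
    have h4 := (ih (n + 1)).fst
    have h5 := (ih (n + 1)).snd
    simp only [backIter, jostStep]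
    refine DifferentiableAt.prodMk ?_ ?_ <;> fun_prop

/-- Local uniformity holds on the whole domain, its real points included. It therefore gives both
holomorphy for Im z > 0 and continuity up to the real line. -/
theorem Decaying.tendstoLocallyUniformlyOn_jostVec (h : Decaying a p q) (n : ℤ) :
    TendstoLocallyUniformlyOn (fun j z => backIter (jostStep a p q z) (1, 0) n j)
      (fun z => jostVec a p q z n) atTop jostDomain := by
  obtain ⟨A, hA⟩ := h.exists_inv_bound
  rw [Metric.tendstoLocallyUniformlyOn_iff]
  intro ε hε z hz
  -- The added 1 leaves room for the same constants to serve on a neighbourhood of z.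
  set B := ‖Complex.cos (z / 2)‖ + 1
  set X := ‖mixing z‖ + 1
  have hB0 : 0 ≤ B := by positivity
  have hX0 : 0 ≤ X := by positivity
  have hA0 : 0 ≤ A := (norm_nonneg _).trans (hA 0)
  have c1 : Tendsto (fun w => ‖Complex.cos (w / 2)‖) (𝓝 z) (𝓝 ‖Complex.cos (z / 2)‖) := by
    have : Continuous fun w => ‖Complex.cos (w / 2)‖ := by fun_prop
    exact this.tendsto z
  have c2 : Tendsto (fun w => ‖mixing w‖) (𝓝 z) (𝓝 ‖mixing z‖) :=
    (differentiableAt_mixing hz.2).continuousAt.norm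
  have n1 : ∀ᶠ w in 𝓝[jostDomain] z, ‖Complex.cos (w / 2)‖ < B :=
    nhdsWithin_le_nhds (c1.eventually (gt_mem_nhds (lt_add_one _)))
  have n2 : ∀ᶠ w in 𝓝[jostDomain] z, ‖mixing w‖ < X :=
    nhdsWithin_le_nhds (c2.eventually (gt_mem_nhds (lt_add_one _)))
  refine ⟨_, n1.and (n2.and self_mem_nhdsWithin), ?_⟩
  set C := Real.exp (∑' k, jostBound a p q B X A k)
  have hlim := tendsto_sum_nat_add fun m : ℕ => C * jostBound a p q B X A (n + m)
  filter_upwards [hlim.eventually (gt_mem_nhds hε)] with j hj w hw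
  obtain ⟨hw1, hw2, hw3⟩ := hw
  rw [dist_comm]
  refine (dist_backIter_backLim_le (jostBound_nonneg hB0 hX0 hA0) (h.summable_jostBound B X A)
    (dist_jostStep_le hw3.1 hw1.le hw2.le hA) (dist_jostStep_unit_le hw3.1 hw1.le hw2.le hA)
    n j).trans_lt ?_
  simpa only [add_comm j] using hj

theorem Decaying.continuousOn_jostSol (h : Decaying a p q) (n : ℤ) :
    ContinuousOn (fun z => jostSol a p q z n) jostDomain := by
  have h1 : ContinuousOn (fun z => jostVec a p q z n) jostDomain :=
    (h.tendstoLocallyUniformlyOn_jostVec n).continuousOn (Frequently.of_forall fun j z hz =>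
      (differentiableAt_jostIter hz.2 j n).continuousAt.continuousWithinAt)
  have h2 : ContinuousOn mixing jostDomain := fun z hz =>
    (differentiableAt_mixing hz.2).continuousAt.continuousWithinAt
  have h3 : ContinuousOn (fun z => zeta z ^ n) jostDomain :=
    differentiable_zeta.continuous.continuousOn.zpow₀ n fun z _ => Or.inl (zeta_ne_zero z)
  exact (continuousOn_const.mul h3).mul (h1.fst.add (h2.mul h1.snd))

theorem mem_jostDomain_of_pos {z : ℂ} (hz : 0 < z.im) : z ∈ jostDomain := by
  refine ⟨hz.le, fun h1 => ?_⟩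
  have h2 : ‖zeta z‖ < 1 := by rw [norm_zeta]; simpa using hz
  have h3 := congrArg norm h1
  rw [norm_pow, norm_one] at h3
  nlinarith [norm_nonneg (zeta z)]

theorem Decaying.differentiableOn_jostSol (h : Decaying a p q) (n : ℤ) :
    DifferentiableOn ℂ (fun z => jostSol a p q z n) {z | 0 < z.im} := by
  have hsub : {z : ℂ | 0 < z.im} ⊆ jostDomain := fun z hz => mem_jostDomain_of_pos hz
  have h1 : DifferentiableOn ℂ (fun z => jostVec a p q z n) {z | 0 < z.im} :=
    ((h.tendstoLocallyUniformlyOn_jostVec n).mono hsub).differentiableOn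
      (Eventually.of_forall fun j z hz =>
        (differentiableAt_jostIter (hsub hz).2 j n).differentiableWithinAt)
      (isOpen_lt continuous_const Complex.continuous_im)
  have h2 : DifferentiableOn ℂ mixing {z | 0 < z.im} := fun z hz =>
    (differentiableAt_mixing (hsub hz).2).differentiableWithinAt
  have h3 : DifferentiableOn ℂ (fun z => zeta z ^ n) {z | 0 < z.im} :=
    differentiable_zeta.differentiableOn.zpow (Or.inl fun z _ => zeta_ne_zero z)
  exact ((differentiableOn_const _).mul h3).mul (h1.fst.add (h2.mul h1.snd))


/-! ### Wronskians -/

theorem wronskian_succ {l : ℂ} {u v : ℤ → ℂ} {k : ℤ} (hu : expr a p q l u (k + 1) = 0)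
    (hv : expr a p q l v (k + 1) = 0) : wronskian a u v (k + 1) = wronskian a u v k := by
  rw [expr_apply] at hu hv
  simp only [add_sub_cancel_right] at hu hv
  simp only [wronskian]
  linear_combination u (k + 1) * hv - v (k + 1) * hu

theorem wronskian_eq_of_le {l : ℂ} {u v : ℤ → ℂ} {m : ℤ} (hu : ∀ n, m < n → expr a p q l u n = 0)
    (hv : ∀ n, expr a p q l v n = 0) {n : ℤ} (hn : m ≤ n) :
    wronskian a u v n = wronskian a u v m := by
  induction n, hn using Int.leInduction with
  | base => rfl
  | succ n hn ih => rw [wronskian_succ (hu _ (by omega)) (hv _), ih]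

/-- A Cramer type identity for arbitrary sequences: where W[f, g] ≠ 0, a sequence whose Wronskians
with f and g both vanish is itself zero. -/
theorem mul_wronskian (u f g : ℤ → ℂ) (n : ℤ) :
    u n * wronskian a f g n = f n * wronskian a u g n - g n * wronskian a u f n := by
  simp only [wronskian]; ring

theorem Decaying.tendsto_atTop (h : Decaying a p q) : Tendsto a atTop (𝓝 1) :=
  h.tendsto_cofinite.mono_left (by rw [Int.cofinite_eq]; exact le_sup_right)

theorem tendsto_int_add_one : Tendsto (fun n : ℤ => n + 1) atTop atTop :=
  tendsto_atTop_add_const_right _ _ tendsto_id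

theorem Decaying.tendsto_wronskian_zero (h : Decaying a p q) {u f : ℤ → ℂ} {C : ℝ}
    (hu : Tendsto u atTop (𝓝 0)) (hf : ∀ᶠ n in atTop, ‖f n‖ ≤ C) :
    Tendsto (wronskian a u f) atTop (𝓝 0) := by
  have hb : IsBoundedUnder (· ≤ ·) atTop fun n => ‖f n‖ := ⟨C, by simpa using hf⟩
  have hb1 : IsBoundedUnder (· ≤ ·) atTop fun n => ‖f (n + 1)‖ :=
    ⟨C, by simpa using tendsto_int_add_one.eventually hf⟩
  have h1 := hu.zero_mul_isBoundedUnder_le hb1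
  have h2 := (hu.comp tendsto_int_add_one).zero_mul_isBoundedUnder_le hb
  have h3 := h.tendsto_atTop.mul (h1.sub h2)
  rw [sub_zero, mul_zero] at h3
  refine h3.congr fun n => ?_
  simp only [wronskian, Function.comp_apply]

/-- A sequence that solves the equation to the right of `m` and tends to zero there vanishes, if
there are two independent bounded solutions. -/
theorem Decaying.eq_zero_of_tendsto_zero (h : Decaying a p q) {l : ℂ} {u f g : ℤ → ℂ} {m : ℤ}
    {C D : ℝ} (hu : ∀ n, m < n → expr a p q l u n = 0) (hu0 : Tendsto u atTop (𝓝 0))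
    (hf : ∀ n, expr a p q l f n = 0) (hg : ∀ n, expr a p q l g n = 0)
    (hfC : ∀ᶠ n in atTop, ‖f n‖ ≤ C) (hgD : ∀ᶠ n in atTop, ‖g n‖ ≤ D)
    (hfg : wronskian a f g 0 ≠ 0) {n : ℤ} (hn : m ≤ n) : u n = 0 := by
  -- W[u, v] is constant from index m on and tends to 0. The equation for u is needed only beyond m,
  -- yet the conclusion includes m itself.
  have key : ∀ {v : ℤ → ℂ} {B : ℝ}, (∀ n, expr a p q l v n = 0) → (∀ᶠ n in atTop, ‖v n‖ ≤ B) →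
      wronskian a u v n = 0 := by
    intro v B hv hvB
    rw [wronskian_eq_of_le hu hv hn]
    refine tendsto_nhds_unique (tendsto_const_nhds.congr' ?_) (h.tendsto_wronskian_zero hu0 hvB)
    filter_upwards [eventually_ge_atTop m] with k hk
    exact (wronskian_eq_of_le hu hv hk).symm
  have h1 := mul_wronskian (a := a) u f g n
  rw [key hf hfC, key hg hgD, mul_zero, mul_zero, sub_zero,
    wronskian_eq_zero_index a p q l f g hf hg] at h1
  exact (mul_eq_zero.1 h1).resolve_right hfg

/-! ### Reflection -/

/-- Since a_n sits on the edge between n and n + 1, reflection sends it to index -n - 1, while p and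
q live on vertices. This transfers every statement at +∞ to -∞. -/
theorem expr_reflect (a p q : ℤ → ℂ) (l : ℂ) (y : ℤ → ℂ) (n : ℤ) :
    expr (fun k => a (-k - 1)) (fun k => p (-k)) (fun k => q (-k)) l (fun k => y (-k)) n =
      expr a p q l y (-n) := by
  rw [expr_apply, expr_apply]
  have e1 : -(n + 1) = -n - 1 := by ring
  have e2 : -(n - 1) = -n + 1 := by ring
  have e3 : -n + 1 - 1 = -n := by ring
  simp only [e1, e2, e3]
  ring

theorem wronskian_reflect (a u v : ℤ → ℂ) (n : ℤ) :
    wronskian (fun k => a (-k - 1)) (fun k => u (-k)) (fun k => v (-k)) n =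
      -wronskian a u v (-n - 1) := by
  simp only [wronskian]
  have e1 : -(n + 1) = -n - 1 := by ring
  rw [e1, sub_add_cancel]
  ring

theorem Decaying.reflect (h : Decaying a p q) :
    Decaying (fun k => a (-k - 1)) (fun k => p (-k)) (fun k => q (-k)) where
  ne_zero _ := h.ne_zero _
  summable_a := h.summable_a.comp_injective (i := fun k : ℤ => -k - 1)
    fun i j hij => by simpa using hij
  summable_p := h.summable_p.comp_injective neg_injective
  summable_q := h.summable_q.comp_injective neg_injective

theorem isJostPlus_reflect_iff {z : ℂ} {y : ℤ → ℂ} :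
    IsJostPlus (fun k => a (-k - 1)) (fun k => p (-k)) (fun k => q (-k)) z (fun k => y (-k)) ↔
      IsJostMinus a p q z y := by
  unfold IsJostPlus IsJostMinus
  refine and_congr ?_ ?_
  · simp only [expr_reflect]
    exact (Equiv.neg ℤ).forall_congr_left.trans (by simp)
  · rw [← map_neg_atTop, tendsto_map'_iff]
    refine iff_of_eq (congrArg (Tendsto · _ _) (funext fun n => ?_))
    simp only [Function.comp_apply]
    rw [zpow_neg, ← inv_zpow]
    norm_num

/-! ### Size of the Jost solutions -/

theorem IsJostPlus.eventually_norm_le {z : ℂ} {y : ℤ → ℂ} (hy : IsJostPlus a p q z y) :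
    ∀ᶠ n : ℤ in atTop, ‖y n‖ ≤ 2 * Real.exp (-(n * z.im)) := by
  have h1 := hy.2.norm
  rw [norm_one] at h1
  filter_upwards [h1.eventually (gt_mem_nhds (by norm_num : (1 : ℝ) < 2))] with n hn
  rw [norm_mul, norm_mul, norm_zpow, norm_neg, norm_one, one_zpow, one_mul, Complex.norm_exp] at hn
  have e : (-(Complex.I * n * z)).re = n * z.im := by simp
  rw [e] at hn
  rw [Real.exp_neg, ← div_eq_mul_inv, le_div_iff₀ (Real.exp_pos _), mul_comm]
  exact hn.le

theorem IsJostPlus.eventually_norm_le_two {z : ℂ} (hz : 0 ≤ z.im) {y : ℤ → ℂ}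
    (hy : IsJostPlus a p q z y) : ∀ᶠ n : ℤ in atTop, ‖y n‖ ≤ 2 := by
  filter_upwards [hy.eventually_norm_le, eventually_ge_atTop 0] with n hn h0
  refine hn.trans ?_
  have h1 : (0 : ℝ) ≤ n := by exact_mod_cast h0
  have h2 : Real.exp (-(n * z.im)) ≤ 1 := Real.exp_le_one_iff.2 (by nlinarith)
  linarith

theorem IsJostPlus.eventually_ne_zero {z : ℂ} {y : ℤ → ℂ} (hy : IsJostPlus a p q z y) :
    ∀ᶠ n : ℤ in atTop, y n ≠ 0 := by
  filter_upwards [hy.2.eventually_ne one_ne_zero] with n hn h0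
  simp [h0] at hn

/-- The Wronskian of the Jost solutions for `z` and `-z`. -/
theorem Decaying.wronskian_jost (h : Decaying a p q) {z : ℂ} {f g : ℤ → ℂ}
    (hf : IsJostPlus a p q z f) (hg : IsJostPlus a p q (-z) g) :
    wronskian a f g 0 = zeta z - (zeta z)⁻¹ := by
  have hg' : ∀ n, expr a p q (2 * Complex.cos (z / 2)) g n = 0 := by
    have := hg.1
    rwa [neg_div, Complex.cos_neg] at this
  have hw := zeta_ne_zero z
  have hlim := h.tendsto_atTop.mul
    (((hf.2.comp tendsto_int_add_one).mul hg.2).const_mul (zeta z) |>.sub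
      ((hf.2.mul (hg.2.comp tendsto_int_add_one)).const_mul (zeta z)⁻¹))
  simp only [mul_one, one_mul] at hlim
  refine tendsto_nhds_unique (tendsto_const_nhds.congr fun n => ?_) hlim
  rw [← wronskian_eq_zero_index a p q _ f g hf.1 hg' n]
  have e1 : ∀ k : ℤ, Complex.exp (-(Complex.I * k * z)) = (zeta z ^ k)⁻¹ := fun k => by
    rw [zeta_zpow, Complex.exp_neg]
  have e2 : ∀ k : ℤ, Complex.exp (-(Complex.I * k * -z)) = zeta z ^ k := fun k => by
    rw [zeta_zpow]; ring_nf
  simp only [Function.comp_apply, e1, e2, wronskian]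
  rw [zpow_add₀ hw, zpow_add₀ (by norm_num : (-1 : ℂ) ≠ 0), zpow_one, zpow_one]
  have hn := neg_one_zpow_mul_self n
  have hw' := zpow_ne_zero n hw
  field_simp
  linear_combination (-(a n * (f n * g (n + 1) - f (n + 1) * g n))) * hn

theorem memℓp_two_of_exp_bound {u : ℤ → ℂ} {C D δ : ℝ} (hδ : 0 < δ)
    (h1 : ∀ᶠ n : ℤ in atTop, ‖u n‖ ≤ C * Real.exp (-(n * δ)))
    (h2 : ∀ᶠ n : ℤ in atTop, ‖u (-n)‖ ≤ D * Real.exp (-(n * δ))) : Memℓp u 2 := by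
  have key : ∀ (v : ℤ → ℂ) (B : ℝ), (∀ᶠ n : ℤ in atTop, ‖v n‖ ≤ B * Real.exp (-(n * δ))) →
      Summable fun n : ℕ => ‖v n‖ ^ 2 := by
    intro v B hv
    have hr : Real.exp (-(2 * δ)) < 1 := by
      rw [← Real.exp_zero]; exact Real.exp_lt_exp.2 (by linarith)
    have hs := (summable_geometric_of_lt_one (Real.exp_pos _).le hr).mul_left (B ^ 2)
    refine Summable.of_norm_bounded_eventually_nat hs ?_
    filter_upwards [tendsto_natCast_atTop_atTop.eventually hv] with n hn
    rw [norm_pow, norm_norm]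
    refine (pow_le_pow_left₀ (norm_nonneg _) hn 2).trans (le_of_eq ?_)
    rw [mul_pow, ← Real.exp_nat_mul, ← Real.exp_nat_mul]
    push_cast
    ring_nf
  rw [memℓp_two_iff]
  exact Summable.of_nat_of_neg (key u C h1) (key (fun n => u (-n)) D h2)

/-! ### The Green function -/

/-- `f n * g m` for `n ≤ m`, and `f m * g n` for `m ≤ n`. -/
def green (f g : ℤ → ℂ) (m n : ℤ) : ℂ := f (min n m) * g (max n m)

/-- Away from m, three consecutive entries of the column are a multiple of f or of g. At m the two
branches meet, and the defect is the Wronskian. Nothing requires it to be nonzero. -/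
theorem expr_green (f g : ℤ → ℂ) (l : ℂ) (hf : ∀ n, expr a p q l f n = 0)
    (hg : ∀ n, expr a p q l g n = 0) (m : ℤ) :
    expr a p q l (green f g m) = Pi.single m (wronskian a f g 0) := by
  rw [← wronskian_eq_zero_index a p q l f g hf hg m]
  funext n
  have h1 := hf n
  have h2 := hg n
  rw [expr_apply] at h1 h2 ⊢
  simp only [green]
  rcases lt_trichotomy n m with hn | rfl | hn
  · rw [Pi.single_eq_of_ne hn.ne, min_eq_left (by omega), min_eq_left (by omega),
      min_eq_left (by omega), max_eq_right (by omega), max_eq_right (by omega),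
      max_eq_right (by omega)]
    linear_combination g m * h1
  · rw [Pi.single_eq_same, min_eq_right (by omega), min_eq_left (by omega), min_self,
      max_eq_left (by omega), max_eq_right (by omega), max_self, wronskian]
    linear_combination g n * h1
  · rw [Pi.single_eq_of_ne hn.ne', min_eq_right (by omega), min_eq_right (by omega),
      min_eq_right (by omega), max_eq_left (by omega), max_eq_left (by omega),
      max_eq_left (by omega)]
    linear_combination f m * h2

theorem IsJostMinus.reflect {z : ℂ} {y : ℤ → ℂ} (h : IsJostMinus a p q z y) :
    IsJostPlus (fun k => a (-k - 1)) (fun k => p (-k)) (fun k => q (-k)) z (fun k => y (-k)) :=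
  isJostPlus_reflect_iff.2 h

theorem memℓp_green {z : ℂ} (hz : 0 < z.im) {f g : ℤ → ℂ} (hf : IsJostMinus a p q z f)
    (hg : IsJostPlus a p q z g) (m : ℤ) : Memℓp (green f g m) 2 := by
  refine memℓp_two_of_exp_bound (C := ‖f m‖ * 2) (D := 2 * ‖g m‖) hz ?_ ?_
  · filter_upwards [hg.eventually_norm_le, eventually_ge_atTop m] with n hn hm
    rw [green, min_eq_right hm, max_eq_left hm, norm_mul, mul_assoc]
    gcongr
  · filter_upwards [hf.reflect.eventually_norm_le, eventually_ge_atTop (-m)] with n hn hm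
    rw [green, min_eq_left (by omega), max_eq_right (by omega), norm_mul, mul_right_comm]
    gcongr

/-- f does not vanish far to the left, nor g far to the right. This supplies a null vector when the
Wronskian is zero, and a nonvanishing numerator at a pole. -/
theorem exists_green_ne_zero {z : ℂ} {f g : ℤ → ℂ} (hf : IsJostMinus a p q z f)
    (hg : IsJostPlus a p q z g) : ∃ m, green f g m ≠ 0 := by
  obtain ⟨n, hn, hn0⟩ := (hf.reflect.eventually_ne_zero.and (eventually_ge_atTop 0)).exists
  obtain ⟨m, hm, hm0⟩ := (hg.eventually_ne_zero.and (eventually_ge_atTop 0)).exists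
  refine ⟨m, fun h => mul_ne_zero hn hm ?_⟩
  have := congrFun h (-n)
  rwa [green, min_eq_left (by omega), max_eq_right (by omega)] at this

/-- If the Wronskian vanished, a nonzero column of the Green function would be a square summable
solution. -/
theorem wronskian_ne_zero_of_injective (h : Decaying a p q) {z : ℂ} (hz : 0 < z.im) {f g : ℤ → ℂ}
    (hf : IsJostMinus a p q z f) (hg : IsJostPlus a p q z g)
    (hi : Function.Injective (pencil a p q (2 * Complex.cos (z / 2)))) :
    wronskian a f g 0 ≠ 0 := by
  intro h0
  obtain ⟨m, hm⟩ := exists_green_ne_zero hf hg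
  refine hm ((injective_pencil_iff h _).1 hi _ (memℓp_green hz hf hg m) fun n => ?_)
  rw [expr_green f g _ hf.1 hg.1, h0, Pi.single_zero, Pi.zero_apply]

theorem tendsto_zero_of_memℓp {y : ℤ → ℂ} (hy : Memℓp y 2) : Tendsto y cofinite (𝓝 0) := by
  have h := (memℓp_two_iff.1 hy).tendsto_cofinite_zero
  rw [tendsto_zero_iff_norm_tendsto_zero]
  simpa using h.sqrt

theorem tendsto_atTop_of_memℓp {y : ℤ → ℂ} (hy : Memℓp y 2) : Tendsto y atTop (𝓝 0) :=
  (tendsto_zero_of_memℓp hy).mono_left (by rw [Int.cofinite_eq]; exact le_sup_right)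

theorem Memℓp.reflect {y : ℤ → ℂ} (hy : Memℓp y 2) : Memℓp (fun n => y (-n)) 2 := by
  rw [memℓp_two_iff] at hy ⊢
  exact hy.comp_injective neg_injective

/-- For a square summable solution y, W[y, g] vanishes by letting n → ∞ and W[y, f] by letting n →
-∞, so `mul_wronskian` forces y = 0. -/
theorem injective_of_wronskian_ne_zero (h : Decaying a p q) {z : ℂ} (hz : 0 < z.im) {f g : ℤ → ℂ}
    (hf : IsJostMinus a p q z f) (hg : IsJostPlus a p q z g) (hw : wronskian a f g 0 ≠ 0) :
    Function.Injective (pencil a p q (2 * Complex.cos (z / 2))) := by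
  rw [injective_pencil_iff h]
  intro y hy hy0
  have key : ∀ (a p q y g : ℤ → ℂ), Decaying a p q → Memℓp y 2 → IsJostPlus a p q z g →
      (∀ n, expr a p q (2 * Complex.cos (z / 2)) y n = 0) → ∀ n, wronskian a y g n = 0 := by
    intro a p q y g h hy hg hy0 n
    refine tendsto_nhds_unique (tendsto_const_nhds.congr fun k => ?_)
      (h.tendsto_wronskian_zero (tendsto_atTop_of_memℓp hy) (hg.eventually_norm_le_two hz.le))
    rw [wronskian_eq_zero_index a p q _ y g hy0 hg.1 n, wronskian_eq_zero_index a p q _ y g hy0 hg.1 k]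
  have h1 := key a p q y g h hy hg hy0
  have h2 := key _ _ _ _ _ h.reflect (Memℓp.reflect hy) hf.reflect fun n => by
    rw [expr_reflect]; exact hy0 _
  funext n
  have h3 := mul_wronskian (a := a) y f g n
  have h4 := h2 (-n - 1)
  rw [wronskian_reflect, neg_eq_zero] at h4
  have e : -(-n - 1) - 1 = n := by ring
  rw [e] at h4
  rw [h1 n, h4, mul_zero, mul_zero, sub_zero, wronskian_eq_zero_index a p q _ f g hf.1 hg.1] at h3
  exact (mul_eq_zero.1 h3).resolve_right hw

theorem injective_of_mem_resolventSet {l : ℂ} (hl : l ∈ resolventSet a p q) :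
    Function.Injective (pencil a p q l) := by
  obtain ⟨R, hR⟩ := hl
  intro y w hyw
  refine Subtype.ext ?_
  rw [← hR.2 y, ← hR.2 w, hyw]

theorem isBoundedInverse_resolvent {l : ℂ} (hl : l ∈ resolventSet a p q) :
    IsBoundedInverse (pencil a p q l) (resolvent a p q l) := by
  have hl' : ∃ R : Ell2 →L[ℂ] Ell2, IsBoundedInverse (pencil a p q l) R := hl
  rw [resolvent, dif_pos hl']
  exact hl'.choose_spec

/-- The kernel of the resolvent, times the Wronskian, is the Green function. -/
theorem wronskian_mul_resolventKernel (h : Decaying a p q) {z : ℂ} (hz : 0 < z.im) {f g : ℤ → ℂ}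
    (hf : IsJostMinus a p q z f) (hg : IsJostPlus a p q z g)
    (hl : 2 * Complex.cos (z / 2) ∈ resolventSet a p q) (n m : ℤ) :
    wronskian a f g 0 * resolventKernel a p q (2 * Complex.cos (z / 2)) n m = green f g m n := by
  have hR := (isBoundedInverse_resolvent hl).2 ⟨⟨green f g m, memℓp_green hz hf hg m⟩,
    h.mem_domain _ _⟩
  have hL : pencil a p q (2 * Complex.cos (z / 2))
      ⟨⟨green f g m, memℓp_green hz hf hg m⟩, h.mem_domain _ _⟩ =
        wronskian a f g 0 • lp.single 2 m (1 : ℂ) := by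
    refine lp.ext ((expr_green f g _ hf.1 hg.1 m).trans ?_)
    rw [← lp.single_smul, smul_eq_mul, mul_one]
    rfl
  rw [hL, map_smul] at hR
  exact congrFun (congrArg (fun v : Ell2 => (v : ℤ → ℂ)) hR) n


/-! ### The Wronskian as a function of z -/

/-- The Jost solution at `-∞`, obtained from the one at `+∞` by reflection. -/
def jostSolMinus (a p q : ℤ → ℂ) (z : ℂ) (n : ℤ) : ℂ :=
  jostSol (fun k => a (-k - 1)) (fun k => p (-k)) (fun k => q (-k)) z (-n)

theorem Decaying.isJostMinus_jostSolMinus (h : Decaying a p q) {z : ℂ} (hz : z ∈ jostDomain) :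
    IsJostMinus a p q z (jostSolMinus a p q z) := by
  rw [← isJostPlus_reflect_iff]
  simpa only [jostSolMinus, neg_neg] using h.reflect.isJostPlus_jostSol hz

/-- The Wronskian of the constructed Jost solutions. -/
def jostWronskian (a p q : ℤ → ℂ) (z : ℂ) : ℂ :=
  wronskian a (jostSolMinus a p q z) (jostSol a p q z) 0

theorem Decaying.continuousOn_jostWronskian (h : Decaying a p q) :
    ContinuousOn (jostWronskian a p q) jostDomain :=
  continuousOn_const.mul (((h.reflect.continuousOn_jostSol _).mul (h.continuousOn_jostSol _)).sub
    ((h.reflect.continuousOn_jostSol _).mul (h.continuousOn_jostSol _)))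

theorem Decaying.differentiableOn_jostWronskian (h : Decaying a p q) :
    DifferentiableOn ℂ (jostWronskian a p q) {z | 0 < z.im} :=
  (differentiableOn_const _).mul
    (((h.reflect.differentiableOn_jostSol _).mul (h.differentiableOn_jostSol _)).sub
      ((h.reflect.differentiableOn_jostSol _).mul (h.differentiableOn_jostSol _)))

/-! ### Points inside the continuous spectrum -/

theorem neg_mem_jostDomain {z : ℂ} (hz : z ∈ jostDomain) (h0 : z.im = 0) : -z ∈ jostDomain := by
  refine ⟨by simp [h0], fun h1 => hz.2 ?_⟩
  have e : zeta (-z) = (zeta z)⁻¹ := by rw [zeta, zeta, mul_neg, Complex.exp_neg]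
  rwa [e, inv_pow, inv_eq_one] at h1

/-- For real z the Jost solutions at z and -z satisfy the same equation, as cos is even. Both are
bounded, and their Wronskian ζ - ζ⁻¹ is nonzero. -/
theorem Decaying.eq_zero_right (h : Decaying a p q) {z : ℂ} (hz : z ∈ jostDomain) (h0 : z.im = 0)
    {u : ℤ → ℂ} {m : ℤ} (hu : ∀ n, m < n → expr a p q (2 * Complex.cos (z / 2)) u n = 0)
    (hu0 : Tendsto u atTop (𝓝 0)) {n : ℤ} (hn : m ≤ n) : u n = 0 := by
  have hf := h.isJostPlus_jostSol hz
  have hz' := neg_mem_jostDomain hz h0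
  have hg := h.isJostPlus_jostSol hz'
  have hg1 := hg.1
  rw [neg_div, Complex.cos_neg] at hg1
  refine h.eq_zero_of_tendsto_zero hu hu0 hf.1 hg1 (hf.eventually_norm_le_two hz.1)
    (hg.eventually_norm_le_two hz'.1) ?_ hn
  rw [h.wronskian_jost hf hg]
  intro h1
  have hw := zeta_ne_zero z
  refine hz.2 ?_
  rw [sub_eq_zero] at h1
  rw [pow_two]
  nth_rewrite 1 [h1]
  exact inv_mul_cancel₀ hw

theorem Decaying.eq_zero_left (h : Decaying a p q) {z : ℂ} (hz : z ∈ jostDomain) (h0 : z.im = 0)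
    {u : ℤ → ℂ} {m : ℤ} (hu : ∀ n, n < m → expr a p q (2 * Complex.cos (z / 2)) u n = 0)
    (hu0 : Tendsto u atBot (𝓝 0)) {n : ℤ} (hn : n ≤ m) : u n = 0 := by
  have h1 := h.reflect.eq_zero_right hz h0 (u := fun k => u (-k)) (m := -m)
    (fun n hn => by rw [expr_reflect]; exact hu _ (by omega))
    (hu0.comp tendsto_neg_atTop_atBot) (n := -n) (by omega)
  simpa using h1

/-- On the real line |e^{inz}| = 1, so the difference of two Jost solutions is a solution tending to
zero. -/
theorem IsJostPlus.unique (h : Decaying a p q) {z : ℂ} (hz : z ∈ jostDomain) (h0 : z.im = 0)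
    {y w : ℤ → ℂ} (hy : IsJostPlus a p q z y) (hw : IsJostPlus a p q z w) : y = w := by
  have h1 := hy.2.sub hw.2
  rw [sub_self, tendsto_zero_iff_norm_tendsto_zero] at h1
  have h2 : Tendsto (y - w) atTop (𝓝 0) := by
    rw [tendsto_zero_iff_norm_tendsto_zero]
    refine h1.congr fun n => ?_
    rw [← mul_sub, norm_mul, norm_mul, norm_zpow, norm_neg, norm_one, one_zpow, Complex.norm_exp]
    simp [h0]
  refine sub_eq_zero.1 (funext fun n => ?_)
  refine h.eq_zero_right hz h0 (m := n) (fun k _ => ?_) h2 le_rfl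
  rw [map_sub, Pi.sub_apply, hy.1, hw.1, sub_zero]

theorem IsJostMinus.unique (h : Decaying a p q) {z : ℂ} (hz : z ∈ jostDomain) (h0 : z.im = 0)
    {y w : ℤ → ℂ} (hy : IsJostMinus a p q z y) (hw : IsJostMinus a p q z w) : y = w := by
  have h1 := IsJostPlus.unique h.reflect hz h0 hy.reflect hw.reflect
  funext n
  simpa using congrFun h1 (-n)

theorem Decaying.jostPlus_eq (h : Decaying a p q) {z : ℂ} (hz : z ∈ jostDomain) (h0 : z.im = 0) :
    jostPlus a p q z = jostSol a p q z := by
  have hex : ∃ y, IsJostPlus a p q z y := ⟨_, h.isJostPlus_jostSol hz⟩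
  rw [jostPlus, dif_pos hex]
  exact IsJostPlus.unique h hz h0 hex.choose_spec (h.isJostPlus_jostSol hz)

theorem Decaying.jostMinus_eq (h : Decaying a p q) {z : ℂ} (hz : z ∈ jostDomain) (h0 : z.im = 0) :
    jostMinus a p q z = jostSolMinus a p q z := by
  have hex : ∃ y, IsJostMinus a p q z y := ⟨_, h.isJostMinus_jostSolMinus hz⟩
  rw [jostMinus, dif_pos hex]
  exact IsJostMinus.unique h hz h0 hex.choose_spec (h.isJostMinus_jostSolMinus hz)

theorem Decaying.Phi_eq (h : Decaying a p q) {z : ℂ} (hz : z ∈ jostDomain) (h0 : z.im = 0) :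
    Phi a p q z = jostWronskian a p q z := by
  rw [Phi, h.jostPlus_eq hz h0, h.jostMinus_eq hz h0, jostWronskian]

theorem Decaying.injective_of_real (h : Decaying a p q) {z : ℂ} (hz : z ∈ jostDomain)
    (h0 : z.im = 0) : Function.Injective (pencil a p q (2 * Complex.cos (z / 2))) := by
  rw [injective_pencil_iff h]
  intro y hy hy0
  funext n
  exact h.eq_zero_right hz h0 (m := n) (fun k _ => hy0 k) (tendsto_atTop_of_memℓp hy) le_rfl

/-- A preimage u of the unit vector at 0 would solve the equation on both half lines and tend to
zero. It would then vanish everywhere, contradicting the equation at 0. -/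
theorem Decaying.notMem_resolventSet_of_real (h : Decaying a p q) {z : ℂ} (hz : z ∈ jostDomain)
    (h0 : z.im = 0) : 2 * Complex.cos (z / 2) ∉ resolventSet a p q := by
  rintro ⟨R, hR, -⟩
  obtain ⟨hd, he⟩ := hR (lp.single 2 0 (1 : ℂ))
  set u : ℤ → ℂ := ((R (lp.single 2 0 (1 : ℂ)) : Ell2) : ∀ _ : ℤ, ℂ) with hu
  have hu2 : Memℓp u 2 := lp.memℓp _
  have he1 : expr a p q (2 * Complex.cos (z / 2)) u = Pi.single 0 1 :=
    congrArg (fun v : Ell2 => (v : ℤ → ℂ)) he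
  have hne : ∀ n : ℤ, n ≠ 0 → expr a p q (2 * Complex.cos (z / 2)) u n = 0 := fun n hn => by
    rw [he1, Pi.single_eq_of_ne hn]
  have hbot : Tendsto u atBot (𝓝 0) :=
    (tendsto_zero_of_memℓp hu2).mono_left (by rw [Int.cofinite_eq]; exact le_sup_left)
  have hr : ∀ n, 0 ≤ n → u n = 0 := fun n hn =>
    h.eq_zero_right hz h0 (m := 0) (fun k hk => hne k hk.ne') (tendsto_atTop_of_memℓp hu2) hn
  have hl : ∀ n, n ≤ 0 → u n = 0 := fun n hn =>
    h.eq_zero_left hz h0 (m := 0) (fun k hk => hne k hk.ne) hbot hn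
  have h1 := congrFun he1 0
  rw [expr_apply, Pi.single_eq_same, hr _ le_rfl, hr (0 + 1) (by norm_num),
    hl (0 - 1) (by norm_num)] at h1
  simp at h1

theorem expr_single (l : ℂ) (m : ℤ) : expr a p q l (Pi.single m 1) =
    (Pi.single (m - 1) (a (m - 1)) : ℤ → ℂ) + (Pi.single (m + 1) (a m) : ℤ → ℂ) +
      (Pi.single m (q m - a m - a (m - 1) + 2 * l * p m + l ^ 2) : ℤ → ℂ) := by
  funext n
  rw [expr_apply]
  simp only [Pi.add_apply, Pi.single_apply]
  by_cases h1 : n = m - 1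
  · subst h1
    simp [show ¬ m - 1 - 1 = m by omega, show ¬ m - 1 = m + 1 by omega]
  by_cases h2 : n = m + 1
  · subst h2
    simp [show ¬ m + 1 + 1 = m by omega, show ¬ m + 1 = m - 1 by omega]
  by_cases h3 : n = m
  · subst h3
    simp [show ¬ n = n - 1 by omega]
  have h4 : n + 1 ≠ m := by omega
  have h5 : n - 1 ≠ m := by omega
  simp [h1, h2, h3, h4, h5]

/-- The matrix of the pencil is symmetric, so the complex conjugate of a vector orthogonal to the
range is a square summable solution, hence zero. -/
theorem Decaying.dense_range_of_injective (h : Decaying a p q) {l : ℂ}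
    (hi : Function.Injective (pencil a p q l)) : Dense (Set.range (pencil a p q l)) := by
  set T := freePencil l + perturbation a p q l with hT
  have hrange : Set.range (pencil a p q l) = LinearMap.range (T : Ell2 →ₗ[ℂ] Ell2) := by
    ext w
    constructor
    · rintro ⟨y, rfl⟩
      exact ⟨y, lp.ext (h.freePencil_add_perturbation_apply l y)⟩
    · rintro ⟨y, rfl⟩
      exact ⟨⟨y, h.mem_domain l y⟩, lp.ext (h.freePencil_add_perturbation_apply l y).symm⟩
  rw [hrange, ← Submodule.dense_iff_topologicalClosure_eq_top.symm.eq,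
    Submodule.topologicalClosure_eq_top_iff, Submodule.eq_bot_iff]
  intro v hv
  have hv1 : ∀ m, expr a p q l (fun n => (starRingEnd ℂ) (v n)) m = 0 := by
    intro m
    have h1 : inner ℂ (T (lp.single 2 m (1 : ℂ))) v = 0 := hv _ ⟨_, rfl⟩
    have h2 : T (lp.single 2 m (1 : ℂ)) =
        (lp.single 2 (m - 1) (a (m - 1)) : Ell2) + (lp.single 2 (m + 1) (a m) : Ell2) +
          (lp.single 2 m (q m - a m - a (m - 1) + 2 * l * p m + l ^ 2) : Ell2) := by
      refine lp.ext ?_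
      rw [hT, h.freePencil_add_perturbation_apply]
      exact expr_single l m
    rw [h2, inner_add_left, inner_add_left, lp.inner_single_left, lp.inner_single_left,
      lp.inner_single_left] at h1
    simp only [RCLike.inner_apply] at h1
    have h3 := congrArg (starRingEnd ℂ) h1
    simp only [map_add, map_mul, Complex.conj_conj, map_zero] at h3
    rw [expr_apply]
    linear_combination h3
  have hv2 : Memℓp (fun n => (starRingEnd ℂ) (v n)) 2 :=
    (lp.memℓp v).mono' fun n => by simp
  have h4 := (injective_pencil_iff h l).1 hi _ hv2 hv1
  refine lp.ext (funext fun n => ?_)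
  have h5 := congrFun h4 n
  simpa using h5

theorem Decaying.mem_continuousSpectrum_of_real (h : Decaying a p q) {z : ℂ} (hz : z ∈ jostDomain)
    (h0 : z.im = 0) : 2 * Complex.cos (z / 2) ∈ continuousSpectrum a p q :=
  ⟨h.injective_of_real hz h0, h.dense_range_of_injective (h.injective_of_real hz h0),
    h.notMem_resolventSet_of_real hz h0⟩

/-! ### The Wronskian does not vanish identically -/

theorem Decaying.bounded_a (h : Decaying a p q) : ∃ A : ℝ, ∀ n, ‖a n‖ ≤ A := by
  refine ⟨1 + ∑' n, ‖1 - a n‖, fun n => ?_⟩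
  have h1 := h.summable_a.le_tsum n fun _ _ => norm_nonneg _
  have h2 : ‖a n‖ ≤ ‖(1 : ℂ)‖ + ‖1 - a n‖ := by
    have := norm_sub_le (1 : ℂ) (1 - a n)
    rwa [sub_sub_cancel] at this
  rw [norm_one] at h2
  linarith

theorem Decaying.exists_injective_of_large (h : Decaying a p q) :
    ∃ R : ℝ, ∀ l : ℂ, R < ‖l‖ → Function.Injective (pencil a p q l) := by
  obtain ⟨A, hA⟩ := h.bounded_a
  set P := ∑' n, ‖p n‖
  set Q := ∑' n, ‖q n‖
  have hP : ∀ n, ‖p n‖ ≤ P := fun n => h.summable_p.le_tsum n fun _ _ => norm_nonneg _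
  have hQ : ∀ n, ‖q n‖ ≤ Q := fun n => h.summable_q.le_tsum n fun _ _ => norm_nonneg _
  have hA0 : 0 ≤ A := (norm_nonneg _).trans (hA 0)
  have hP0 : 0 ≤ P := (norm_nonneg _).trans (hP 0)
  have hQ0 : 0 ≤ Q := (norm_nonneg _).trans (hQ 0)
  -- In sup norm, l² y is bounded by (4A + Q + 2|l|P) S. The summand 1 ensures |l| ≥ 1, so this is
  -- at most |l| (4A + Q + 2P) S.
  refine ⟨1 + (4 * A + Q + 2 * P), fun l hl => (injective_pencil_iff h l).2 fun y hy hy0 => ?_⟩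
  have hbdd : BddAbove (Set.range fun n => ‖y n‖) := by
    refine ⟨‖(⟨y, hy⟩ : Ell2)‖, ?_⟩
    rintro _ ⟨n, rfl⟩
    exact lp.norm_apply_le_norm (by simp) (⟨y, hy⟩ : Ell2) n
  set S := ⨆ n, ‖y n‖
  have hS : ∀ n, ‖y n‖ ≤ S := fun n => le_ciSup hbdd n
  have hS0 : 0 ≤ S := (norm_nonneg _).trans (hS 0)
  have hl1 : 1 ≤ ‖l‖ := by linarith
  have key : ∀ n, ‖l‖ ^ 2 * ‖y n‖ ≤ ‖l‖ * (4 * A + Q + 2 * P) * S := by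
    intro n
    have h1 := hy0 n
    rw [expr_apply] at h1
    have h2 : l ^ 2 * y n = -(a n * y (n + 1) + a (n - 1) * y (n - 1)
        + (q n - a n - a (n - 1) + 2 * l * p n) * y n) := by linear_combination h1
    have h3 : ‖q n - a n - a (n - 1) + 2 * l * p n‖ ≤ Q + A + A + 2 * ‖l‖ * P := by
      refine (norm_add_le _ _).trans (add_le_add ((norm_sub_le _ _).trans (add_le_add
        ((norm_sub_le _ _).trans (add_le_add (hQ n) (hA n))) (hA _))) ?_)
      rw [norm_mul, norm_mul, Complex.norm_ofNat]
      gcongr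
      exact hP n
    rw [← norm_pow, ← norm_mul, h2, norm_neg]
    calc _ ≤ A * S + A * S + (Q + A + A + 2 * ‖l‖ * P) * S := by
          refine (norm_add_le _ _).trans (add_le_add ((norm_add_le _ _).trans (add_le_add ?_ ?_)) ?_)
          · rw [norm_mul]; exact mul_le_mul (hA _) (hS _) (norm_nonneg _) hA0
          · rw [norm_mul]; exact mul_le_mul (hA _) (hS _) (norm_nonneg _) hA0
          · rw [norm_mul]; exact mul_le_mul h3 (hS _) (norm_nonneg _) (by positivity)
      _ = (4 * A + Q + 2 * ‖l‖ * P) * S := by ring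
      _ ≤ _ := by
          refine mul_le_mul_of_nonneg_right ?_ hS0
          nlinarith
  have h4 : ‖l‖ * S ≤ (4 * A + Q + 2 * P) * S := by
    have h5 : S ≤ ‖l‖ * (4 * A + Q + 2 * P) * S / ‖l‖ ^ 2 := ciSup_le fun n => by
      rw [le_div_iff₀ (by positivity), mul_comm]
      exact key n
    rw [le_div_iff₀ (by positivity)] at h5
    refine le_of_mul_le_mul_left (a := ‖l‖) ?_ (by positivity)
    linarith
  have h6 : S = 0 := by nlinarith
  funext n
  have h7 := hS n
  rw [h6] at h7
  exact norm_le_zero_iff.1 h7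

theorem Decaying.exists_jostWronskian_ne_zero (h : Decaying a p q) :
    ∃ z : ℂ, 0 < z.im ∧ jostWronskian a p q z ≠ 0 := by
  obtain ⟨R, hR⟩ := h.exists_injective_of_large
  -- At z = it, λ = 2 cosh(t/2) > e^{t/2} > t/2 ≥ R.
  set t : ℝ := 2 * max R 1
  have ht : 0 < t := by have := le_max_right R 1; positivity
  refine ⟨t * Complex.I, by simpa using ht, ?_⟩
  have hz : 0 < ((t : ℂ) * Complex.I).im := by simpa using ht
  refine wronskian_ne_zero_of_injective h hz (h.isJostMinus_jostSolMinus (mem_jostDomain_of_pos hz))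
    (h.isJostPlus_jostSol (mem_jostDomain_of_pos hz)) (hR _ ?_)
  have e : (t : ℂ) * Complex.I / 2 = ((t / 2 : ℝ) : ℂ) * Complex.I := by push_cast; ring
  rw [e, Complex.cos_mul_I, ← Complex.ofReal_cosh, norm_mul, Complex.norm_ofNat,
    Complex.norm_real, Real.norm_of_nonneg (Real.cosh_pos _).le, Real.cosh_eq]
  have h1 := Real.add_one_le_exp (t / 2)
  have h2 := Real.exp_pos (-(t / 2))
  have h3 : R ≤ t / 2 := by
    have := le_max_left R 1
    simp only [t]; linarith
  linarith

/-- Vanishing near a boundary point includes an open piece of the half plane, so the identity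
theorem would make the Wronskian zero throughout. -/
theorem Decaying.not_eventually_jostWronskian_eq_zero (h : Decaying a p q) {z₀ : ℂ}
    (h0 : z₀.im = 0) : ¬ ∀ᶠ z in 𝓝 z₀, 0 < z.im → jostWronskian a p q z = 0 := by
  intro hev
  have hopen : IsOpen {z : ℂ | 0 < z.im} := isOpen_lt continuous_const Complex.continuous_im
  have htend : Tendsto (fun t : ℝ => z₀ + t * Complex.I) (𝓝[>] 0) (𝓝 z₀) := by
    have hc : Continuous fun t : ℝ => z₀ + t * Complex.I := by fun_prop
    have := hc.tendsto 0
    simp only [Complex.ofReal_zero, zero_mul, add_zero] at this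
    exact this.mono_left nhdsWithin_le_nhds
  obtain ⟨t, ht, ht0⟩ := ((htend.eventually hev.eventually_nhds).and self_mem_nhdsWithin).exists
  have hz1 : z₀ + t * Complex.I ∈ {z : ℂ | 0 < z.im} := by
    simpa [h0] using ht0
  obtain ⟨w, hw, hw0⟩ := h.exists_jostWronskian_ne_zero
  have hpre : IsPreconnected {z : ℂ | 0 < z.im} := (convex_halfSpace_im_gt 0).isPreconnected
  refine hw0 ((h.differentiableOn_jostWronskian.analyticOnNhd hopen)
    |>.eqOn_zero_of_preconnected_of_eventuallyEq_zero hpre hz1 ?_ hw)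
  filter_upwards [ht, hopen.mem_nhds hz1] with z hz hz2
  exact hz hz2

/-! ### Poles of the kernel -/

/-- The kernel of the resolvent has a pole on the side of the cut that corresponds to the upper
half plane of the variable `z` exactly where the Wronskian vanishes. -/
theorem Decaying.kernelPoleWithin_iff (h : Decaying a p q) {z₀ : ℂ} (hz : z₀ ∈ jostDomain)
    (h0 : z₀.im = 0) (hsin : Complex.sin (z₀ / 2) ≠ 0) {H : Set ℂ}
    (hH : ∀ᶠ z in 𝓝 z₀, (2 * Complex.cos (z / 2) ∈ H ↔ 0 < z.im)) :
    KernelPoleWithin a p q H (2 * Complex.cos (z₀ / 2)) ↔ jostWronskian a p q z₀ = 0 := by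
  have hder : HasStrictDerivAt (fun z : ℂ => 2 * Complex.cos (z / 2)) (-Complex.sin (z₀ / 2)) z₀ := by
    have h1 := ((hasStrictDerivAt_id z₀).div_const 2).ccos.const_mul 2
    refine h1.congr_deriv ?_
    simp only [id]; ring
  set l₀ := 2 * Complex.cos (z₀ / 2) with hl₀
  have hd0 : -Complex.sin (z₀ / 2) ≠ 0 := neg_ne_zero.2 hsin
  -- The branch of z as a function of λ near λ₀. By `hH` it takes points of H near λ₀ into Im z > 0.
  set g := hder.localInverse _ _ _ hd0 with hg
  have hright : ∀ᶠ l in 𝓝 l₀, 2 * Complex.cos (g l / 2) = l :=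
    (hder.hasStrictFDerivAt_equiv hd0).eventually_right_inverse
  have hgt : Tendsto g (𝓝 l₀) (𝓝 z₀) :=
    (hder.hasStrictFDerivAt_equiv hd0).localInverse_tendsto
  have hcos : Tendsto (fun z : ℂ => 2 * Complex.cos (z / 2)) (𝓝 z₀) (𝓝 l₀) :=
    hder.hasDerivAt.continuousAt
  set F := 𝓝[resolventSet a p q ∩ H] l₀ with hF
  have hpos : ∀ᶠ l in F, 0 < (g l).im := by
    filter_upwards [nhdsWithin_le_nhds hright, nhdsWithin_le_nhds (hgt.eventually hH),
      self_mem_nhdsWithin] with l h1 h2 h3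
    rw [h1] at h2
    exact h2.1 h3.2
  have hgF : Tendsto g F (𝓝[jostDomain] z₀) :=
    tendsto_nhdsWithin_iff.2 ⟨hgt.mono_left nhdsWithin_le_nhds,
      hpos.mono fun l hl => mem_jostDomain_of_pos hl⟩
  have hW : Tendsto (fun l => jostWronskian a p q (g l)) F (𝓝 (jostWronskian a p q z₀)) :=
    (h.continuousOn_jostWronskian z₀ hz).tendsto.comp hgF
  have hG : ∀ n m, Tendsto (fun l => green (jostSolMinus a p q (g l)) (jostSol a p q (g l)) m n) F
      (𝓝 (green (jostSolMinus a p q z₀) (jostSol a p q z₀) m n)) := fun n m =>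
    ((h.reflect.continuousOn_jostSol _ z₀ hz).tendsto.comp hgF).mul
      ((h.continuousOn_jostSol _ z₀ hz).tendsto.comp hgF)
  have hker : ∀ᶠ l in F, jostWronskian a p q (g l) ≠ 0 ∧ ∀ n m, resolventKernel a p q l n m =
      green (jostSolMinus a p q (g l)) (jostSol a p q (g l)) m n / jostWronskian a p q (g l) := by
    filter_upwards [nhdsWithin_le_nhds hright, hpos, self_mem_nhdsWithin] with l h1 h2 h3
    have hm := h.isJostMinus_jostSolMinus (mem_jostDomain_of_pos h2)
    have hp := h.isJostPlus_jostSol (mem_jostDomain_of_pos h2)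
    have h4 := h3.1
    rw [← h1] at h4
    have hne : jostWronskian a p q (g l) ≠ 0 :=
      wronskian_ne_zero_of_injective h h2 hm hp (injective_of_mem_resolventSet h4)
    refine ⟨hne, fun n m => ?_⟩
    rw [eq_div_iff hne, mul_comm]
    have h5 := wronskian_mul_resolventKernel h h2 hm hp h4 n m
    rwa [h1] at h5
  constructor
  · rintro ⟨hbot, n, m, hnm⟩
    -- With a nonzero limiting Wronskian every entry of the kernel has a finite limit.
    by_contra hne
    have h1 := ((hG n m).div hW hne).norm
    refine not_tendsto_nhds_of_tendsto_atTop hnm _ (h1.congr' ?_)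
    filter_upwards [hker] with l hl
    rw [hl.2]
    rfl
  · intro hzero
    refine ⟨?_, ?_⟩
    -- If no point of ρ ∩ H came near λ₀, the Wronskian would vanish at all z near z₀ with Im z > 0,
    -- since a nonzero value puts λ in ρ.
    · by_contra hbot
      rw [not_neBot, ← empty_mem_iff_bot, mem_nhdsWithin_iff_eventually] at hbot
      refine h.not_eventually_jostWronskian_eq_zero h0 ?_
      filter_upwards [hcos.eventually hbot, hH] with z h1 h2 h3
      by_contra hne
      refine h1 ⟨h.mem_resolventSet_of_injective h3 (injective_of_wronskian_ne_zero h h3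
        (h.isJostMinus_jostSolMinus (mem_jostDomain_of_pos h3))
        (h.isJostPlus_jostSol (mem_jostDomain_of_pos h3)) hne), h2.2 h3⟩
    · have hm := h.isJostMinus_jostSolMinus hz
      have hp := h.isJostPlus_jostSol hz
      obtain ⟨m, hgm⟩ := exists_green_ne_zero hm hp
      obtain ⟨n, hn⟩ := Function.ne_iff.1 hgm
      refine ⟨n, m, ?_⟩
      have h1 : Tendsto (fun l => ‖jostWronskian a p q (g l)‖) F (𝓝[>] 0) := by
        refine tendsto_nhdsWithin_iff.2 ⟨by simpa [hzero] using hW.norm, ?_⟩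
        filter_upwards [hker] with l hl
        exact norm_pos_iff.2 hl.1
      have h2 := (hG n m).norm.pos_mul_atTop (norm_pos_iff.2 hn) h1.inv_tendsto_nhdsGT_zero
      refine h2.congr' ?_
      filter_upwards [hker] with l hl
      rw [hl.2, norm_div, div_eq_mul_inv]
      rfl

/-! ### The parametrization of the segment -/

/-- Near real x, points with Im z > 0 go to the lower side of the cut when sin(x/2) > 0 and to the
upper side when sin(x/2) < 0. -/
theorem im_two_mul_cos_half (z : ℂ) : (2 * Complex.cos (z / 2)).im =
    -(2 * (Real.sin (z.re / 2) * Real.sinh (z.im / 2))) := by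
  have e : z / 2 = ((z.re / 2 : ℝ) : ℂ) + ((z.im / 2 : ℝ) : ℂ) * Complex.I := by
    apply Complex.ext <;> simp
  rw [e, Complex.cos_add_mul_I, ← Complex.ofReal_cos, ← Complex.ofReal_cosh, ← Complex.ofReal_sin,
    ← Complex.ofReal_sinh]
  simp only [Complex.mul_im, Complex.sub_im, Complex.sub_re, Complex.mul_re, Complex.ofReal_re,
    Complex.ofReal_im, Complex.I_re, Complex.I_im, Complex.re_ofNat, Complex.im_ofNat]
  ring

theorem eventually_upper_iff {x : ℝ} (hx : Real.sin (x / 2) < 0) :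
    ∀ᶠ z in 𝓝 (x : ℂ), (2 * Complex.cos (z / 2) ∈ {l : ℂ | 0 < l.im} ↔ 0 < z.im) := by
  have hc : Continuous fun z : ℂ => Real.sin (z.re / 2) := by fun_prop
  filter_upwards [(hc.tendsto (x : ℂ)).eventually (gt_mem_nhds (by simpa using hx))] with z hz
  rw [im_two_mul_cos_half]
  constructor
  · intro h1
    have h2 : 0 < Real.sinh (z.im / 2) := by nlinarith
    have := Real.sinh_pos_iff.1 h2
    linarith
  · intro h1
    have h2 : 0 < Real.sinh (z.im / 2) := Real.sinh_pos_iff.2 (by linarith)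
    nlinarith

theorem eventually_lower_iff {x : ℝ} (hx : 0 < Real.sin (x / 2)) :
    ∀ᶠ z in 𝓝 (x : ℂ), (2 * Complex.cos (z / 2) ∈ {l : ℂ | l.im < 0} ↔ 0 < z.im) := by
  have hc : Continuous fun z : ℂ => Real.sin (z.re / 2) := by fun_prop
  filter_upwards [(hc.tendsto (x : ℂ)).eventually (lt_mem_nhds (by simpa using hx))] with z hz
  rw [im_two_mul_cos_half]
  constructor
  · intro h1
    have h2 : 0 < Real.sinh (z.im / 2) := by
      by_contra h3
      nlinarith [not_lt.1 h3]
    have := Real.sinh_pos_iff.1 h2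
    linarith
  · intro h1
    have h2 : 0 < Real.sinh (z.im / 2) := Real.sinh_pos_iff.2 (by linarith)
    nlinarith

theorem mem_jostDomain_of_mem_P0 {z : ℝ} (hz : z ∈ P0) : (z : ℂ) ∈ jostDomain := by
  refine ⟨by simp, fun h1 => ?_⟩
  rw [zeta, ← Complex.exp_nat_mul, Complex.exp_eq_one_iff] at h1
  obtain ⟨k, hk⟩ := h1
  have h2 : (z : ℂ) = ((k * Real.pi : ℝ) : ℂ) := by
    have hI := Complex.I_ne_zero
    push_cast at hk ⊢
    refine mul_left_cancel₀ (mul_ne_zero two_ne_zero hI) ?_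
    linear_combination hk
  have h3 : z = k * Real.pi := Complex.ofReal_injective h2
  obtain ⟨⟨h4, h5⟩, h6⟩ := hz
  have hpi := Real.pi_pos
  have h7 : (-1 : ℝ) < k := by
    by_contra hc
    nlinarith [not_lt.1 hc]
  have h8 : (k : ℝ) < 3 := by
    by_contra hc
    nlinarith [not_lt.1 hc]
  have h9 : -1 < k := by exact_mod_cast h7
  have h10 : k < 3 := by exact_mod_cast h8
  apply h6
  rw [h3]
  interval_cases k <;> simp

/-- By λ² = 2 + ζ + ζ⁻¹, λ = 0 forces ζ = -1 and λ = ±2 forces ζ = 1. Both are excluded by ζ² ≠ 1.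
-/
theorem notMem_thresholds {z : ℂ} (hz : z ∈ jostDomain) :
    2 * Complex.cos (z / 2) ∉ ({0, 2, -2} : Set ℂ) := by
  have hw := zeta_ne_zero z
  have hsq : (2 * Complex.cos (z / 2)) ^ 2 = 2 + zeta z + (zeta z)⁻¹ := by
    rw [two_mul_cos_half_sq, Complex.exp_neg]; rfl
  have key : ∀ c : ℂ, c ^ 2 = 1 → 2 + zeta z + (zeta z)⁻¹ = 2 + 2 * c → False := by
    intro c hc h1
    field_simp at h1
    have h2 : (zeta z - c) ^ 2 = 0 := by linear_combination h1 + hc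
    refine hz.2 ?_
    rw [sub_eq_zero.1 (pow_eq_zero_iff two_ne_zero |>.1 h2), hc]
  rintro (h1 | h1 | h1)
  · exact key (-1) (by norm_num) (by rw [← hsq, h1]; norm_num)
  · exact key 1 (by norm_num) (by rw [← hsq, h1]; norm_num)
  · rw [Set.mem_singleton_iff] at h1
    exact key 1 (by norm_num) (by rw [← hsq, h1]; norm_num)

theorem sin_half_ne_zero {z : ℂ} (hz : z ∈ jostDomain) : Complex.sin (z / 2) ≠ 0 := by
  intro h1
  have h2 := Complex.sin_sq_add_cos_sq (z / 2)
  rw [h1] at h2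
  have h3 : (2 * Complex.cos (z / 2) - 2) * (2 * Complex.cos (z / 2) + 2) = 0 := by
    linear_combination 4 * h2
  have h4 := notMem_thresholds hz
  simp only [Set.mem_insert_iff, Set.mem_singleton_iff, not_or] at h4
  rcases mul_eq_zero.1 h3 with h5 | h5
  · exact h4.2.1 (sub_eq_zero.1 h5)
  · exact h4.2.2 (eq_neg_of_add_eq_zero_left h5)

/-- The interval (-π, 3π) is one period of cos(z/2), so each remaining value is taken twice, with
opposite signs of sin(z/2): one parameter for each side of the cut. -/
theorem exists_mem_P0 {x : ℝ} (h0 : Real.cos x ≠ 0) (h1 : Real.cos x ≠ 1)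
    (h2 : Real.cos x ≠ -1) :
    (∃ z ∈ P0, Real.cos (z / 2) = Real.cos x ∧ 0 < Real.sin (z / 2)) ∧
      ∃ z ∈ P0, Real.cos (z / 2) = Real.cos x ∧ Real.sin (z / 2) < 0 := by
  set t := Real.arccos (Real.cos x) with ht
  have hct : Real.cos t = Real.cos x := Real.cos_arccos (Real.neg_one_le_cos x) (Real.cos_le_one x)
  have hpi := Real.pi_pos
  have t0 : t ≠ 0 := fun h => h1 (by rw [← hct, h, Real.cos_zero])
  have t1 : t ≠ Real.pi := fun h => h2 (by rw [← hct, h, Real.cos_pi])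
  have t2 : t ≠ Real.pi / 2 := fun h => h0 (by rw [← hct, h, Real.cos_pi_div_two])
  have ht0 : 0 < t := lt_of_le_of_ne (Real.arccos_nonneg _) t0.symm
  have ht1 : t < Real.pi := lt_of_le_of_ne (Real.arccos_le_pi _) t1
  have hs : 0 < Real.sin t := Real.sin_pos_of_pos_of_lt_pi ht0 ht1
  refine ⟨⟨2 * t, ⟨⟨by linarith, by linarith⟩, ?_⟩, ?_, ?_⟩, ?_⟩
  · rintro (h | h | h)
    · linarith
    · exact t2 (by linarith)
    · rw [Set.mem_singleton_iff] at h; linarith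
  · rw [mul_div_cancel_left₀ _ two_ne_zero, hct]
  · rwa [mul_div_cancel_left₀ _ two_ne_zero]
  -- The second preimage -2t must be moved by the period 4π when it falls to the left of -π.
  · rcases lt_or_gt_of_ne t2 with h | h
    · refine ⟨-(2 * t), ⟨⟨by linarith, by linarith⟩, ?_⟩, ?_, ?_⟩
      · rintro (h | h | h)
        · linarith
        · linarith
        · rw [Set.mem_singleton_iff] at h; linarith
      · rw [neg_div, mul_div_cancel_left₀ _ two_ne_zero, Real.cos_neg, hct]
      · rw [neg_div, mul_div_cancel_left₀ _ two_ne_zero, Real.sin_neg]; linarith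
    · have e : (4 * Real.pi - 2 * t) / 2 = 2 * Real.pi - t := by ring
      refine ⟨4 * Real.pi - 2 * t, ⟨⟨by linarith, by linarith⟩, ?_⟩, ?_, ?_⟩
      · rintro (h | h | h)
        · linarith
        · linarith
        · rw [Set.mem_singleton_iff] at h; linarith
      · rw [e, Real.cos_two_pi_sub, hct]
      · rw [e, Real.sin_two_pi_sub]; linarith

/-! ### The set of spectral singularities -/

theorem Decaying.spectralSingularities_eq (h : Decaying a p q) : spectralSingularities a p q =
    {l : ℂ | ∃ z ∈ P0, l = 2 * Complex.cos ((z : ℂ) / 2) ∧ Phi a p q (z : ℂ) = 0} := by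
  have hiff : ∀ z ∈ P0, ∀ H : Set ℂ,
      (∀ᶠ w in 𝓝 (z : ℂ), (2 * Complex.cos (w / 2) ∈ H ↔ 0 < w.im)) →
      (KernelPoleWithin a p q H (2 * Complex.cos ((z : ℂ) / 2)) ↔ Phi a p q (z : ℂ) = 0) := by
    intro z hz H hH
    have hd := mem_jostDomain_of_mem_P0 hz
    rw [h.Phi_eq hd (Complex.ofReal_im z)]
    exact h.kernelPoleWithin_iff hd (Complex.ofReal_im z) (sin_half_ne_zero hd) hH
  ext l
  constructor
  · rintro ⟨hc, ht, hpole⟩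
    obtain ⟨w, hw⟩ := Complex.cos_surjective (l / 2)
    have hlw : 2 * Complex.cos w = l := by rw [hw]; ring
    -- Off the cut λ = 2cos(z/2) for some z with Im z > 0, as cos is even, and there injectivity
    -- already gives λ ∈ ρ.
    have hre : w.im = 0 := by
      by_contra hne
      obtain ⟨z, hz, hlz⟩ : ∃ z : ℂ, 0 < z.im ∧ 2 * Complex.cos (z / 2) = l := by
        rcases lt_or_gt_of_ne hne with h1 | h1
        · refine ⟨-(2 * w), by simp; linarith, ?_⟩
          rw [neg_div, Complex.cos_neg, mul_div_cancel_left₀ _ two_ne_zero, hlw]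
        · refine ⟨2 * w, by simpa using h1, ?_⟩
          rw [mul_div_cancel_left₀ _ two_ne_zero, hlw]
      have h2 := hc.1
      have h3 := hc.2.2
      rw [← hlz] at h2 h3
      exact h3 (h.mem_resolventSet_of_injective hz h2)
    have hwr : w = (w.re : ℂ) := Complex.ext rfl (by simp [hre])
    have hl : l = 2 * ((Real.cos w.re : ℝ) : ℂ) := by
      rw [Complex.ofReal_cos, ← hwr, hlw]
    simp only [Set.mem_insert_iff, Set.mem_singleton_iff, not_or] at ht
    obtain ⟨⟨z, hz, hz1, hz2⟩, ⟨z', hz', hz1', hz2'⟩⟩ := exists_mem_P0 (x := w.re)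
      (fun h1 => ht.1 (by rw [hl, h1]; simp))
      (fun h1 => ht.2.1 (by rw [hl, h1]; simp))
      (fun h1 => ht.2.2 (by rw [hl, h1]; simp))
    have hcast : ∀ z : ℝ, Real.cos (z / 2) = Real.cos w.re →
        l = 2 * Complex.cos ((z : ℂ) / 2) := by
      intro z hz
      rw [hl, ← hz]
      push_cast
      rfl
    -- The side of the pole selects the parameter: sin(z/2) < 0 for the upper side, sin(z/2) > 0 for
    -- the lower.
    rcases hpole with hpole | hpole
    · refine ⟨z', hz', hcast z' hz1', ?_⟩
      rw [hcast z' hz1'] at hpole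
      exact (hiff z' hz' _ (eventually_upper_iff hz2')).1 hpole
    · refine ⟨z, hz, hcast z hz1, ?_⟩
      rw [hcast z hz1] at hpole
      exact (hiff z hz _ (eventually_lower_iff hz2)).1 hpole
  · rintro ⟨z, hz, rfl, hPhi⟩
    have hd := mem_jostDomain_of_mem_P0 hz
    refine ⟨h.mem_continuousSpectrum_of_real hd (Complex.ofReal_im z), notMem_thresholds hd, ?_⟩
    have hs : Real.sin (z / 2) ≠ 0 := fun h1 => sin_half_ne_zero hd (by
      have := congrArg (fun r : ℝ => (r : ℂ)) h1
      simpa using this)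
    rcases lt_or_gt_of_ne hs with h1 | h1
    · exact Or.inl ((hiff z hz _ (eventually_upper_iff h1)).2 hPhi)
    · exact Or.inr ((hiff z hz _ (eventually_lower_iff h1)).2 hPhi)

end QuadPencil

end

theorem corollary5 (a p q : ℤ → ℂ) (ha : ∀ n, a n ≠ 0)
    (hsum : Summable fun n : ℤ => |(n : ℝ)| * (‖1 - a n‖ + ‖p n‖ + ‖q n‖)) :
    (∀ z ∈ QuadPencil.P0,
      (∃! y : ℤ → ℂ, QuadPencil.IsJostPlus a p q (z : ℂ) y) ∧
      (∃! y : ℤ → ℂ, QuadPencil.IsJostMinus a p q (z : ℂ) y)) ∧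
    QuadPencil.spectralSingularities a p q =
      {l : ℂ | ∃ z ∈ QuadPencil.P0,
        l = 2 * Complex.cos ((z : ℂ) / 2) ∧ QuadPencil.Phi a p q (z : ℂ) = 0} := by
  have h := QuadPencil.decaying_of_summable ha hsum
  refine ⟨fun z hz => ?_, h.spectralSingularities_eq⟩
  have hd := QuadPencil.mem_jostDomain_of_mem_P0 hz
  have h0 := Complex.ofReal_im z
  exact ⟨⟨_, h.isJostPlus_jostSol hd, fun y hy =>
      QuadPencil.IsJostPlus.unique h hd h0 hy (h.isJostPlus_jostSol hd)⟩,
    ⟨_, h.isJostMinus_jostSolMinus hd, fun y hy =>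
      QuadPencil.IsJostMinus.unique h hd h0 hy (h.isJostMinus_jostSolMinus hd)⟩⟩
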